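/- For a finite group $G$, let $\mu(G)$ denote its minimal degree, the least integer $m\ge 0$ such that $G$ embeds in the symmetric group $\mathrm{Sym}(m)$. A finite group $G$ is called exceptional if it has a normal subgroup $N$ with $\mu(G)<\mu(G/N)$; then $N$ is called a distinguished subgroup and $G/N$ a distinguished quotient. Write $[a,b]=a^{-1}b^{-1}ab$. Let $p$ be an odd prime and let $\alpha$ be any integer that is a quadratic non-residue modulo $p$. Define the groups $$G_1=\langle x,y,z \mid x^{p^2}=y^p=z^p=1,\ [x,y]=1,\ [x,z]=1,\ [y,z]=x^p\rangle,$$ $$G_2=\langle x,y,z \mid x^{p^2}=y^p=z^{p^2}=1,\ z^p=x^p,\ [x,y]=x^p,\ [x,z]=y,\ [y,z]=1\rangle,$$ $$G_3=\langle x,y,z \mid x^{p^2}=y^p=z^{p^2}=1,\ z^p=x^{\alpha p},\ [x,y]=x^p,\ [x,z]=y,\ [y,z]=1\rangle,$$ $$E_1=\langle x,y,z,n \mid x^{p^2}=y^p=z^p=n^p=1,\ [y,z]=x^pn^{-1},\ [x,z]=n,\ [x,y]=[x,n]=[y,n]=[z,n]=1\rangle,$$ $$E_2=\langle x,y,z,n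 \mid x^{p^2}=y^p=z^{p^2}=n^p=1,\ x^p=z^pn,\ [x,y]=x^p,\ [x,z]=y,\ [y,z]=[x,n]=[y,n]=[z,n]=1\rangle,$$ $$E_3=\langle x,y,z,n \mid x^{p^2}=y^p=z^{p^2}=n^p=1,\ z^p=x^{\alpha p}n,\ [x,z]=yn,\ [x,y]=x^p,\ [y,z]=[x,n]=[y,n]=[z,n]=1\rangle.$$ Then $E_1$, $E_2$, $E_3$ are exceptional groups of order $p^5$ and minimal degree $\mu(E_i)=2p^2$. More precisely, for $i=1,2,3$ the subgroup $\langle n\rangle$ of $E_i$ is central and distinguished, and $E_i/\langle n\rangle\cong G_i$; moreover $\mu(G_1)>2p^2$ and $\mu(G_2)=\mu(G_3)=p^3$. -/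

import Mathlib

namespace ExceptionalPGroups

/-- The minimal degree of a (finite) group `G`: the least `m` such that `G` embeds in `Sym(m)`.
For finite `G` the set is nonempty by Cayley's theorem. -/
noncomputable def minimalDegree (G : Type*) [Group G] : ℕ :=
  sInf {m : ℕ | ∃ f : G →* Equiv.Perm (Fin m), Function.Injective f}

/-- `N` is a distinguished subgroup of `G`: it is normal and `μ(G) < μ(G/N)`. -/
def IsDistinguished {G : Type*} [Group G] (N : Subgroup G) : Prop :=
  ∃ _ : N.Normal, minimalDegree G < minimalDegree (G ⧸ N)

/-- A finite group is exceptional if it has a distinguished subgroup. -/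
def IsExceptional (G : Type*) [Group G] : Prop :=
  Finite G ∧ ∃ N : Subgroup G, IsDistinguished N

/-- `N` is normal in `G` and the quotient `G/N` is isomorphic to `Q`. -/
def HasQuotientIso {G : Type*} [Group G] (N : Subgroup G) (Q : Type*) [Group Q] : Prop :=
  ∃ _ : N.Normal, Nonempty ((G ⧸ N) ≃* Q)

/-- The commutator `[a, b] = a⁻¹ b⁻¹ a b` (conjugation being `a ^ b = b⁻¹ a b`). -/
def comm {F : Type*} [Group F] (a b : F) : F := a⁻¹ * b⁻¹ * a * b

/-- The three generators of `G₁`, `G₂`, `G₃`. -/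
inductive Gen3 : Type
  | x | y | z

/-- The four generators of `E₁`, `E₂`, `E₃`. -/
inductive Gen4 : Type
  | x | y | z | n

section Relators

/-! A relation `u = v` is recorded as the relator `u * v⁻¹`. -/

variable {F : Type*} [Group F]

/-- `x^{p²} = y^p = z^p = 1`, `[x,y] = 1`, `[x,z] = 1`, `[y,z] = x^p`. -/
def relG1 (p : ℕ) (x y z : F) : Set F :=
  {x ^ (p ^ 2), y ^ p, z ^ p, comm x y, comm x z, comm y z * (x ^ p)⁻¹}

/-- `x^{p²} = y^p = z^{p²} = 1`, `z^p = x^p`, `[x,y] = x^p`, `[x,z] = y`, `[y,z] = 1`. -/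
def relG2 (p : ℕ) (x y z : F) : Set F :=
  {x ^ (p ^ 2), y ^ p, z ^ (p ^ 2), z ^ p * (x ^ p)⁻¹,
    comm x y * (x ^ p)⁻¹, comm x z * y⁻¹, comm y z}

/-- `x^{p²} = y^p = z^{p²} = 1`, `z^p = x^{αp}`, `[x,y] = x^p`, `[x,z] = y`, `[y,z] = 1`. -/
def relG3 (p : ℕ) (α : ℤ) (x y z : F) : Set F :=
  {x ^ (p ^ 2), y ^ p, z ^ (p ^ 2), z ^ p * (x ^ (α * (p : ℤ)))⁻¹,
    comm x y * (x ^ p)⁻¹, comm x z * y⁻¹, comm y z}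

/-- `x^{p²} = y^p = z^p = n^p = 1`, `[y,z] = x^p n⁻¹`, `[x,z] = n`,
`[x,y] = [x,n] = [y,n] = [z,n] = 1`. -/
def relE1 (p : ℕ) (x y z n : F) : Set F :=
  {x ^ (p ^ 2), y ^ p, z ^ p, n ^ p, comm y z * (x ^ p * n⁻¹)⁻¹, comm x z * n⁻¹,
    comm x y, comm x n, comm y n, comm z n}

/-- `x^{p²} = y^p = z^{p²} = n^p = 1`, `x^p = z^p n`, `[x,y] = x^p`, `[x,z] = y`,
`[y,z] = [x,n] = [y,n] = [z,n] = 1`. -/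
def relE2 (p : ℕ) (x y z n : F) : Set F :=
  {x ^ (p ^ 2), y ^ p, z ^ (p ^ 2), n ^ p, x ^ p * (z ^ p * n)⁻¹,
    comm x y * (x ^ p)⁻¹, comm x z * y⁻¹, comm y z, comm x n, comm y n, comm z n}

/-- `x^{p²} = y^p = z^{p²} = n^p = 1`, `z^p = x^{αp} n`, `[x,z] = y n`, `[x,y] = x^p`,
`[y,z] = [x,n] = [y,n] = [z,n] = 1`. -/
def relE3 (p : ℕ) (α : ℤ) (x y z n : F) : Set F :=
  {x ^ (p ^ 2), y ^ p, z ^ (p ^ 2), n ^ p, z ^ p * (x ^ (α * (p : ℤ)) * n)⁻¹,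
    comm x z * (y * n)⁻¹, comm x y * (x ^ p)⁻¹, comm y z, comm x n, comm y n, comm z n}

end Relators

abbrev G1 (p : ℕ) : Type :=
  PresentedGroup (relG1 p (FreeGroup.of Gen3.x) (FreeGroup.of Gen3.y) (FreeGroup.of Gen3.z))

abbrev G2 (p : ℕ) : Type :=
  PresentedGroup (relG2 p (FreeGroup.of Gen3.x) (FreeGroup.of Gen3.y) (FreeGroup.of Gen3.z))

abbrev G3 (p : ℕ) (α : ℤ) : Type :=
  PresentedGroup (relG3 p α (FreeGroup.of Gen3.x) (FreeGroup.of Gen3.y) (FreeGroup.of Gen3.z))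

abbrev E1 (p : ℕ) : Type :=
  PresentedGroup (relE1 p (FreeGroup.of Gen4.x) (FreeGroup.of Gen4.y) (FreeGroup.of Gen4.z)
    (FreeGroup.of Gen4.n))

abbrev E2 (p : ℕ) : Type :=
  PresentedGroup (relE2 p (FreeGroup.of Gen4.x) (FreeGroup.of Gen4.y) (FreeGroup.of Gen4.z)
    (FreeGroup.of Gen4.n))

abbrev E3 (p : ℕ) (α : ℤ) : Type :=
  PresentedGroup (relE3 p α (FreeGroup.of Gen4.x) (FreeGroup.of Gen4.y) (FreeGroup.of Gen4.z)
    (FreeGroup.of Gen4.n))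

/-- The subgroup `⟨n⟩` of `E₁`. -/
def N1 (p : ℕ) : Subgroup (E1 p) := Subgroup.zpowers (PresentedGroup.of Gen4.n)

/-- The subgroup `⟨n⟩` of `E₂`. -/
def N2 (p : ℕ) : Subgroup (E2 p) := Subgroup.zpowers (PresentedGroup.of Gen4.n)

/-- The subgroup `⟨n⟩` of `E₃`. -/
def N3 (p : ℕ) (α : ℤ) : Subgroup (E3 p α) := Subgroup.zpowers (PresentedGroup.of Gen4.n)

end ExceptionalPGroups

namespace ExceptionalPGroups

/-! ### Minimal degree: bounds from faithful actions and from point stabilisers. -/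

open MulAction

/-! The upper bound `2 * p ^ 2` comes from explicit faithful actions on two sets of `p ^ 2` points.
`E₁` acts on `(ℤ/p)²` through a Heisenberg group and on `ℤ/p²` through the nonabelian group of order
`p ^ 3` generated by `a ↦ a + 1` and `a ↦ a - p a`. For `E₂` and `E₃` put `w = [x, z]`, which is `y`
in `E₂` and `y n` in `E₃`. The generator `n` is then redundant, and both groups satisfy the same
relations `ClassThreeRel` and are realised by the same permutations: on `ℤ/p²`, `x` is translation
by `1` while `w` and `z` have the form `a ↦ a + p q(a)`; moreover `z` translates a second copy of
`ℤ/p²`. Collecting shows that the normal forms exhaust each group, so its order is at most `p ^ 5`;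
distinct normal forms have distinct images, so the order is exactly `p ^ 5` and the action is
faithful.

The lower bound is `two_mul_sq_le_minimalDegree`. Let `A` be central of order at least `p ^ 2` and
contained in all subgroups of index `p`. On fewer than `2 * p ^ 2` points there is at most one orbit
of length at least `p ^ 2`, and `A` and all commutators act trivially on the other orbits.
Faithfulness forces the large orbit to exist, to have length `p ^ 2`, and its stabiliser `H` to be a
complement of the central subgroup `A`. Then every commutator lies in `H`, hence acts trivially, and
the group is abelian. Here `A` is `⟨x ^ p, n⟩` for `E₁` and `⟨x ^ p, z ^ p⟩` for `E₂` and `E₃`.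

For the quotients, a faithful action moves a point by `x ^ p`, so it suffices that a subgroup
avoiding `x ^ p` has order at most `p`, hence index at least `p ^ 3` (both lemmas
`card_le_of_notMem`). In `G₂` and `G₃` the subgroup `⟨w⟩` is core-free of index `p ^ 3`, so equality
holds. Since `p` is odd, `2 * p ^ 2 < p ^ 3`, and `⟨n⟩` is distinguished. -/

theorem minimalDegree_le {G α : Type*} [Group G] [Finite α] (f : G →* Equiv.Perm α)
    (hf : Function.Injective f) : minimalDegree G ≤ Nat.card α := by
  refine Nat.sInf_le ⟨(Finite.equivFin α).permCongrHom.toMonoidHom.comp f, ?_⟩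
  exact (Finite.equivFin α).permCongrHom.injective.comp hf

theorem le_minimalDegree {G : Type*} [Group G] [Finite G] {d : ℕ}
    (h : ∀ m, ∀ f : G →* Equiv.Perm (Fin m), Function.Injective f → d ≤ m) :
    d ≤ minimalDegree G := by
  -- The infimum of the empty set is `0`, so a lower bound needs some faithful action; Cayley's
  -- theorem provides one.
  have hne : {m : ℕ | ∃ f : G →* Equiv.Perm (Fin m), Function.Injective f}.Nonempty := by
    refine ⟨Nat.card G, (Finite.equivFin G).permCongrHom.toMonoidHom.comp (toPermHom G G), ?_⟩
    exact (Finite.equivFin G).permCongrHom.injective.comp toPerm_injective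
  exact le_csInf hne fun m ⟨f, hf⟩ => h m f hf

theorem minimalDegree_congr {G H : Type*} [Group G] [Group H] (e : G ≃* H) :
    minimalDegree G = minimalDegree H := by
  unfold minimalDegree
  congr 1
  ext m
  constructor
  · rintro ⟨f, hf⟩
    exact ⟨f.comp e.symm.toMonoidHom, hf.comp e.symm.injective⟩
  · rintro ⟨f, hf⟩
    exact ⟨f.comp e.toMonoidHom, hf.comp e.injective⟩

/-- A central element fixing a point fixes the whole orbit of that point. -/
theorem smul_eq_of_mem_orbit_of_mem_center {G α : Type*} [Group G] [MulAction G α] {a : G}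
    (ha : a ∈ Subgroup.center G) {i j : α} (hij : j ∈ orbit G i) (hi : a • i = i) :
    a • j = j := by
  obtain ⟨g, rfl⟩ := hij
  change a • g • i = g • i
  rw [smul_smul, ← Subgroup.mem_center_iff.1 ha g, mul_smul, hi]

/-- If a central element `c` lies in every subgroup of index less than `d`, then `d` is a lower
bound for the minimal degree. -/
theorem le_minimalDegree_of_forall_index {G : Type*} [Group G] [Finite G] {c : G} (hc1 : c ≠ 1)
    {d : ℕ} (h : ∀ H : Subgroup G, c ∉ H → d ≤ H.index) : d ≤ minimalDegree G := by
  refine le_minimalDegree fun m f hf => ?_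
  let _ : MulAction G (Fin m) := MulAction.compHom (Fin m) f
  have hfc : f c ≠ 1 := fun h0 => hc1 (hf (h0.trans (map_one f).symm))
  obtain ⟨i, hi⟩ : ∃ i, f c i ≠ i := by
    by_contra! hcon
    exact hfc (Equiv.ext hcon)
  have hst : c ∉ stabilizer G i := fun hmem => hi hmem
  refine (h _ hst).trans ?_
  rw [index_stabilizer]
  exact (Set.ncard_le_ncard (Set.subset_univ _)).trans (by simp)

/-- Central factors do not change a commutator. -/
theorem comm_mul_mul_of_mem_center {G : Type*} [Group G] {u v : G} (hu : u ∈ Subgroup.center G)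
    (hv : v ∈ Subgroup.center G) (h k : G) : comm (u * h) (v * k) = comm h k := by
  have hu' := Subgroup.mem_center_iff.1 hu
  have hv' := Subgroup.mem_center_iff.1 hv
  simp only [comm, mul_inv_rev]
  calc h⁻¹ * u⁻¹ * (k⁻¹ * v⁻¹) * (u * h) * (v * k)
      = h⁻¹ * u⁻¹ * k⁻¹ * v⁻¹ * u * (h * v) * k := by group
    _ = h⁻¹ * u⁻¹ * k⁻¹ * v⁻¹ * (u * v) * h * k := by rw [hv']; group
    _ = h⁻¹ * u⁻¹ * (k⁻¹ * u) * h * k := by rw [hv' u]; group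
    _ = h⁻¹ * k⁻¹ * h * k := by rw [hu']; group

/-! ### Subgroups of index `p` and the lower bound `2 * p ^ 2`. -/

section IndexP

variable {G : Type*} [Group G] {p : ℕ}

theorem normal_of_index_eq_prime [Finite G] (hp : p.Prime) (hG : IsPGroup p G) {H : Subgroup G}
    (hH : H.index = p) : H.Normal := by
  have := Fact.mk hp
  refine Subgroup.normal_of_index_eq_minFac_card ?_
  obtain ⟨k, hk⟩ := IsPGroup.iff_card.1 hG
  have hk0 : k ≠ 0 := by
    rintro rfl
    have := H.index_dvd_card
    rw [hk, hH, pow_zero] at this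
    exact hp.one_lt.ne' (Nat.dvd_one.1 this)
  rw [hH, hk, hp.pow_minFac hk0]

theorem comm_mem_of_index_eq_prime [Finite G] (hp : p.Prime) (hG : IsPGroup p G) {H : Subgroup G}
    (hH : H.index = p) (a b : G) : comm a b ∈ H := by
  have := Fact.mk hp
  have := normal_of_index_eq_prime hp hG hH
  have : IsCyclic (G ⧸ H) := isCyclic_of_prime_card (p := p) hH
  let _ : CommGroup (G ⧸ H) := IsCyclic.commGroup
  rw [← QuotientGroup.eq_one_iff]
  simp only [comm, QuotientGroup.mk_mul, QuotientGroup.mk_inv]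
  rw [mul_assoc, mul_comm (QuotientGroup.mk a : G ⧸ H) _]
  group

theorem pow_mem_of_index_eq_prime [Finite G] (hp : p.Prime) (hG : IsPGroup p G) {H : Subgroup G}
    (hH : H.index = p) (a : G) : a ^ p ∈ H := by
  have := normal_of_index_eq_prime hp hG hH
  exact hH ▸ Subgroup.pow_index_mem H a

theorem index_eq_one_or_prime_of_lt [Finite G] (hp : p.Prime) (hG : IsPGroup p G)
    {H : Subgroup G} (hH : H.index < p ^ 2) : H.index = 1 ∨ H.index = p := by
  have := Fact.mk hp
  obtain ⟨k, hk⟩ := hG.index H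
  rw [hk] at hH ⊢
  have : k < 2 := (Nat.pow_lt_pow_iff_right hp.one_lt).1 hH
  interval_cases k <;> simp

/-- A nonabelian finite `p`-group with a central subgroup of order at least `p ^ 2` contained in
all subgroups of index `p` has minimal degree at least `2 * p ^ 2`. -/
theorem two_mul_sq_le_minimalDegree [Finite G] (hp : p.Prime) (hG : IsPGroup p G)
    (A : Subgroup G) (hA : A ≤ Subgroup.center G) (hcard : p ^ 2 ≤ Nat.card A)
    (hAH : ∀ H : Subgroup G, H.index = p → A ≤ H) {g g' : G} (hgg : comm g g' ≠ 1) :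
    2 * p ^ 2 ≤ minimalDegree G := by
  have := Fact.mk hp
  refine le_minimalDegree fun m f hf => ?_
  by_contra! hm
  let _ : MulAction G (Fin m) := MulAction.compHom (Fin m) f
  have hfaith : ∀ a : G, (∀ i : Fin m, a • i = i) → a = 1 := fun a ha =>
    hf ((Equiv.ext ha).trans (map_one f).symm)
  have hsmallA : ∀ i : Fin m, (stabilizer G i).index < p ^ 2 → ∀ a ∈ A, a • i = i := by
    intro i hi a ha
    rcases index_eq_one_or_prime_of_lt hp hG hi with h1 | h1
    · have : a ∈ stabilizer G i := by rw [Subgroup.index_eq_one.1 h1]; trivial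
      exact this
    · exact hAH _ h1 ha
  have hsmallC : ∀ i : Fin m, (stabilizer G i).index < p ^ 2 → ∀ a b : G, comm a b • i = i := by
    intro i hi a b
    rcases index_eq_one_or_prime_of_lt hp hG hi with h1 | h1
    · have : comm a b ∈ stabilizer G i := by rw [Subgroup.index_eq_one.1 h1]; trivial
      exact this
    · exact comm_mem_of_index_eq_prime hp hG h1 a b
  -- If all orbits were short, the nontrivial group `A` would act trivially.
  obtain ⟨i, hi⟩ : ∃ i : Fin m, p ^ 2 ≤ (stabilizer G i).index := by
    by_contra! hcon
    have hbot : A = ⊥ := (Subgroup.eq_bot_iff_forall _).2 fun a ha =>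
      hfaith a fun i => hsmallA i (hcon i) a ha
    rw [hbot, Subgroup.card_bot] at hcard
    exact absurd hcard (not_le.2 (Nat.one_lt_pow two_ne_zero hp.one_lt))
  -- Two disjoint orbits of length at least `p ^ 2` do not fit into fewer than `2 * p ^ 2` points.
  have hother : ∀ j : Fin m, j ∉ orbit G i → (stabilizer G j).index < p ^ 2 := by
    intro j hj
    have hdis : Disjoint (orbit G i) (orbit G j) := by
      rw [Set.disjoint_left]
      intro k hki hkj
      apply hj
      rw [← orbit_eq_iff] at hki hkj ⊢
      rw [← hki, ← hkj]
    have hle := Set.ncard_le_ncard (Set.subset_univ (orbit G i ∪ orbit G j))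
    rw [Set.ncard_union_eq hdis, ← index_stabilizer, ← index_stabilizer, Set.ncard_univ,
      Nat.card_fin] at hle
    omega
  -- The orbit length is a power of `p` in `[p ^ 2, 2 * p ^ 2)`, and `p ^ 3` is already too large.
  have hidx : (stabilizer G i).index = p ^ 2 := by
    obtain ⟨k, hk⟩ := hG.index (stabilizer G i)
    have hle : (stabilizer G i).index < 2 * p ^ 2 := by
      have h2 := Set.ncard_le_ncard (Set.subset_univ (orbit G i))
      rw [← index_stabilizer, Set.ncard_univ, Nat.card_fin] at h2
      omega
    rw [hk] at hi hle ⊢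
    have hk2 : 2 ≤ k := (Nat.pow_le_pow_iff_right hp.one_lt).1 hi
    have hk3 : k < 3 := by
      refine (Nat.pow_lt_pow_iff_right hp.one_lt).1 (hle.trans_le ?_)
      rw [pow_succ' p 2]
      exact Nat.mul_le_mul_right _ hp.two_le
    rw [show k = 2 by omega]
  set H := stabilizer G i with hH
  -- Being central, an element of `A` that fixes `i` fixes the whole large orbit; it fixes the short
  -- orbits anyway.
  have hdisj : Disjoint A H := by
    rw [Subgroup.disjoint_def]
    intro a haA haH
    refine hfaith a fun j => ?_
    by_cases hj : j ∈ orbit G i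
    · exact smul_eq_of_mem_orbit_of_mem_center (hA haA) hj haH
    · exact hsmallA j (hother j hj) a haA
  have hcompl : Subgroup.IsComplement' A H := by
    refine Subgroup.isComplement'_of_card_mul_and_disjoint (le_antisymm ?_ ?_) hdisj
    · have hinj : Function.Injective fun t : A × H => (t.1 : G) * t.2 :=
        Subgroup.mul_injective_of_disjoint hdisj
      simpa using Nat.card_le_card_of_injective _ hinj
    · rw [← H.card_mul_index, hidx, mul_comm]
      exact Nat.mul_le_mul_right _ hcard
  -- Since `G = A H` with `A` central, every commutator is a commutator of elements of `H`.
  have hcommH : ∀ a b : G, comm a b ∈ H := by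
    intro a b
    obtain ⟨⟨⟨u, hu⟩, ⟨h, hh⟩⟩, rfl⟩ := hcompl.2 a
    obtain ⟨⟨⟨v, hv⟩, ⟨k, hk⟩⟩, rfl⟩ := hcompl.2 b
    change comm (u * h) (v * k) ∈ H
    rw [comm_mul_mul_of_mem_center (hA hu) (hA hv)]
    exact H.mul_mem (H.mul_mem (H.mul_mem (H.inv_mem hh) (H.inv_mem hk)) hh) hk
  refine hgg (hfaith _ fun j => ?_)
  by_cases hj : j ∈ orbit G i
  · obtain ⟨t, rfl⟩ := hj
    -- A conjugate of a commutator is again a commutator, so fixing `i` propagates to the point `t •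
    -- i`.
    have h1 : comm (t⁻¹ * g * t) (t⁻¹ * g' * t) • i = i := hcommH _ _
    have h2 : comm g g' * t = t * comm (t⁻¹ * g * t) (t⁻¹ * g' * t) := by
      simp only [comm]; group
    change comm g g' • t • i = t • i
    rw [smul_smul, h2, mul_smul, h1]
  · exact hsmallC j (hother j hj) g g'

end IndexP

/-- A set that contains `1` and is stable under left multiplication by generators of finite order
is everything. -/
theorem mem_of_left_mul_mem {G : Type*} [Group G] {T S : Set G}
    (hT : Subgroup.closure T = ⊤) {k : ℕ} (hk : k ≠ 0) (hfin : ∀ t ∈ T, t ^ k = 1) (h1 : 1 ∈ S)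
    (hS : ∀ t ∈ T, ∀ s ∈ S, t * s ∈ S) (g : G) : g ∈ S := by
  have hg : g ∈ Subgroup.closure T := hT ▸ Subgroup.mem_top g
  have hpow : ∀ t ∈ T, ∀ s ∈ S, ∀ j : ℕ, t ^ j * s ∈ S := by
    intro t ht s hs j
    induction j with
    | zero => simpa using hs
    | succ j ih => rw [pow_succ', mul_assoc]; exact hS t ht _ ih
  induction hg using Subgroup.closure_induction_left with
  | one => exact h1
  | mul_left t ht y _ ih => exact hS t ht y ih
  | inv_mul_cancel t ht y _ ih =>
    have : t⁻¹ = t ^ (k - 1) := by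
      rw [inv_eq_iff_mul_eq_one, ← pow_succ', Nat.sub_add_cancel (Nat.pos_of_ne_zero hk),
        hfin t ht]
    rw [this]
    exact hpow t ht y ih _

/-! ### Powers in cyclic subgroups, collection formulas and counting. -/

section Powers

variable {G : Type*} [Group G]

theorem pow_val_natCast {g : G} {q : ℕ} (h : g ^ q = 1) (a : ℕ) :
    g ^ (a : ZMod q).val = g ^ a := by
  rw [ZMod.val_natCast, ← pow_eq_pow_mod a h]

theorem pow_gcd_mem {H : Subgroup G} {g : G} {k q : ℕ} (hk : g ^ k ∈ H) (hq : g ^ q = 1) :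
    g ^ Nat.gcd k q ∈ H := by
  have h : g ^ ((Nat.gcd k q : ℕ) : ℤ) ∈ H := by
    rw [Nat.gcd_eq_gcd_ab, zpow_add, zpow_mul, zpow_mul, zpow_natCast, zpow_natCast, hq, one_zpow,
      mul_one]
    exact H.zpow_mem hk _
  simpa using h

theorem mem_of_pow_mem {p : ℕ} (hp : p.Prime) {H : Subgroup G} {g : G} {k : ℕ} (hk : g ^ k ∈ H)
    (hg : g ^ p = 1) (hkp : ¬ p ∣ k) : g ∈ H := by
  have := pow_gcd_mem hk hg
  rwa [Nat.Coprime.gcd_eq_one ((hp.coprime_iff_not_dvd.2 hkp).symm), pow_one] at this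

/-- By Bézout, `H` contains `g` to the power `gcd k (p ^ 2)`, and this gcd is `1` or `p`. -/
theorem prime_pow_mem_of_pow_mem {p : ℕ} (hp : p.Prime) {H : Subgroup G} {g : G} {k : ℕ}
    (hk : g ^ k ∈ H) (hg : g ^ p ^ 2 = 1) (hkp : ¬ p ^ 2 ∣ k) : g ^ p ∈ H := by
  have h1 := pow_gcd_mem hk hg
  obtain ⟨j, hj, hj'⟩ := (Nat.dvd_prime_pow hp).1 (Nat.gcd_dvd_right k (p ^ 2))
  have hj2 : j ≠ 2 := by
    rintro rfl
    exact hkp (hj' ▸ Nat.gcd_dvd_left k (p ^ 2))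
  rw [hj'] at h1
  have : j = 0 ∨ j = 1 := by omega
  rcases this with rfl | rfl
  · rw [pow_zero, pow_one] at h1
    exact H.pow_mem h1 p
  · rwa [pow_one] at h1

/-- Collection in class two: moving each of the `c` factors `w` past each of the `a` factors `x`
costs one factor `v`. -/
theorem pow_mul_pow_of_mul_eq {x w v : G} (h : w * x = x * w * v) (hx : Commute v x)
    (hw : Commute v w) (a c : ℕ) : w ^ c * x ^ a = x ^ a * w ^ c * v ^ (a * c) := by
  have h1 : SemiconjBy w x (x * v) := by
    change w * x = x * v * w
    rw [h, mul_assoc, mul_assoc, hw.eq]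
  have h2 : w * x ^ a = x ^ a * v ^ a * w := by
    have := h1.pow_right a
    rwa [hx.symm.mul_pow] at this
  have h3 : SemiconjBy (x ^ a) (w * v ^ a) w := by
    change x ^ a * (w * v ^ a) = w * x ^ a
    rw [h2, mul_assoc, (hw.pow_left a).eq]
  have h4 := h3.pow_right c
  rw [(hw.pow_left a).symm.mul_pow, ← pow_mul] at h4
  rw [mul_assoc, ← h4.eq]

theorem mul_pow_of_mul_eq {x w v : G} (h : w * x = x * w * v) (hx : Commute v x)
    (hw : Commute v w) (k : ℕ) : (x * w) ^ k = x ^ k * w ^ k * v ^ k.choose 2 := by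
  induction k with
  | zero => simp
  | succ k ih =>
    have hc : Commute (v ^ k.choose 2) (x * w) := (hx.mul_right hw).pow_left _
    have h1 : w ^ k * x = x * w ^ k * v ^ k := by
      simpa using pow_mul_pow_of_mul_eq h hx hw 1 k
    calc (x * w) ^ (k + 1) = x ^ k * (w ^ k * x) * w * v ^ k.choose 2 := by
          rw [pow_succ, ih, mul_assoc, hc.eq]; simp only [mul_assoc]
      _ = x ^ k * x * w ^ k * (v ^ k * w) * v ^ k.choose 2 := by rw [h1]; simp only [mul_assoc]
      _ = x ^ (k + 1) * w ^ (k + 1) * (v ^ k * v ^ k.choose 2) := by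
          rw [(hw.pow_left k).eq, pow_succ x, pow_succ w]; simp only [mul_assoc]
      _ = x ^ (k + 1) * w ^ (k + 1) * v ^ (k + 1).choose 2 := by
          rw [← pow_add, Nat.choose_succ_succ' k 1, Nat.choose_one_right]

/-- Products of elements from two disjoint subgroups of order `p` are pairwise distinct. This gives
the size of the central subgroup `A` in the lower bound. -/
theorem sq_le_card_of_disjoint_zpowers [Finite G] {p : ℕ} (hp : p.Prime) {u v : G}
    (hu : u ^ p = 1) (hv : v ^ p = 1) (hu1 : u ≠ 1) (hv1 : v ≠ 1)
    (hd : Disjoint (Subgroup.zpowers u) (Subgroup.zpowers v)) :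
    p ^ 2 ≤ Nat.card (Subgroup.closure {u, v}) := by
  have := Fact.mk hp
  set A := Subgroup.closure {u, v}
  have hinj : Function.Injective fun t : Subgroup.zpowers u × Subgroup.zpowers v =>
      (⟨t.1 * t.2, A.mul_mem
        ((Subgroup.zpowers_le.2 (Subgroup.subset_closure (by simp)) : _ ≤ A) t.1.2)
        ((Subgroup.zpowers_le.2 (Subgroup.subset_closure (by simp)) : _ ≤ A) t.2.2)⟩ : A) := by
    intro s t hst
    exact Subgroup.mul_injective_of_disjoint hd (congrArg Subtype.val hst)
  have := Nat.card_le_card_of_injective _ hinj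
  rwa [Nat.card_prod, Nat.card_zpowers, Nat.card_zpowers, orderOf_eq_prime hu hu1,
    orderOf_eq_prime hv hv1, ← sq] at this

theorem cube_le_index_of_card_le [Finite G] {p : ℕ} (hp : p.Prime) (hG : Nat.card G = p ^ 4)
    {H : Subgroup G} (hH : Nat.card H ≤ p) : p ^ 3 ≤ H.index := by
  have h := H.card_mul_index
  rw [hG] at h
  by_contra! hlt
  have : Nat.card H * H.index < p * p ^ 3 :=
    (Nat.mul_le_mul_right _ hH).trans_lt (Nat.mul_lt_mul_of_pos_left hlt hp.pos)
  rw [h, ← pow_succ'] at this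
  exact this.false

theorem sq_le_card_of_lt [Finite G] {p : ℕ} (hp : p.Prime) (hG : Nat.card G = p ^ 4)
    {H : Subgroup G} (hH : p < Nat.card H) : p ^ 2 ≤ Nat.card H := by
  have := Fact.mk hp
  obtain ⟨k, hk⟩ := IsPGroup.iff_card.1 ((IsPGroup.of_card hG).to_subgroup H)
  rw [hk] at hH ⊢
  refine Nat.pow_le_pow_right hp.pos ?_
  have : 1 < k := (Nat.pow_lt_pow_iff_right hp.one_lt).1 (by simpa using hH)
  exact this

end Powers

/-! ### The relations of `E₁` and `G₁`; the case `n = 1` is `G₁`. -/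

section ClassTwo

/-- The relations of `E₁`, in multiplied-out form. -/
structure ClassTwoRel {G : Type*} [Group G] (p : ℕ) (x y z n : G) : Prop where
  x_pow : x ^ p ^ 2 = 1
  y_pow : y ^ p = 1
  z_pow : z ^ p = 1
  n_pow : n ^ p = 1
  yz : y * z * n = z * y * x ^ p
  xz : x * z = z * x * n
  xy : Commute x y
  xn : Commute x n
  yn : Commute y n
  zn : Commute z n

/-- Generators satisfying `ClassTwoRel`. -/
structure ClassTwoGen {G : Type*} [Group G] (p : ℕ) (x y z n : G) : Prop
    extends ClassTwoRel p x y z n where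
  gen : Subgroup.closure {x, y, z, n} = ⊤

namespace ClassTwoGen

variable {G : Type*} [Group G] {p : ℕ} {x y z n : G}

theorem xp_pow (h : ClassTwoGen p x y z n) : (x ^ p) ^ p = 1 := by
  rw [← pow_mul, ← sq, h.x_pow]

theorem mem_center_of_commute (h : ClassTwoGen p x y z n) {g : G} (hx : Commute x g)
    (hy : Commute y g) (hz : Commute z g) (hn : Commute n g) : g ∈ Subgroup.center G := by
  have : Subgroup.closure {x, y, z, n} ≤ Subgroup.centralizer {g} := by
    rw [Subgroup.closure_le]
    rintro t (rfl | rfl | rfl | rfl) <;>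
      rw [SetLike.mem_coe, Subgroup.mem_centralizer_singleton_iff]
    exacts [hx, hy, hz, hn]
  rw [h.gen] at this
  rw [Subgroup.mem_center_iff]
  intro t
  exact Subgroup.mem_centralizer_singleton_iff.1 (this (Subgroup.mem_top t))

theorem n_mem_center (h : ClassTwoGen p x y z n) : n ∈ Subgroup.center G :=
  h.mem_center_of_commute h.xn h.yn h.zn (Commute.refl n)

/-- Conjugation by `z` takes `x n` to `x`, and `(x n) ^ p = x ^ p` because `n` commutes with `x` and
has `p`-th power `1`. -/
theorem z_xp (h : ClassTwoGen p x y z n) : Commute z (x ^ p) := by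
  have h1 : SemiconjBy z (x * n) x := by
    change z * (x * n) = x * z
    rw [h.xz, mul_assoc]
  have h2 := h1.pow_right p
  rwa [h.xn.mul_pow, h.n_pow, mul_one] at h2

theorem xp_mem_center (h : ClassTwoGen p x y z n) : x ^ p ∈ Subgroup.center G :=
  h.mem_center_of_commute (Commute.self_pow x p) (h.xy.pow_left p).symm h.z_xp
    (h.xn.pow_left p).symm

theorem comm_xz (h : ClassTwoGen p x y z n) : comm x z = n := by
  rw [comm, mul_assoc, h.xz]; group

theorem comm_yz (h : ClassTwoGen p x y z n) : comm y z = x ^ p * n⁻¹ := by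
  have h1 : y * z = z * y * x ^ p * n⁻¹ := by rw [← h.yz, mul_inv_cancel_right]
  rw [comm, mul_assoc, h1]; group

theorem mem_normalForm (h : ClassTwoGen p x y z n) (hp : p ≠ 0) (g : G) :
    ∃ c a b d : ℕ, g = z ^ c * x ^ a * y ^ b * n ^ d := by
  have hnc := Subgroup.mem_center_iff.1 h.n_mem_center
  -- This is the central commutator `[y, z]`, with `n⁻¹` written as `n ^ (p - 1)` to keep all
  -- exponents natural numbers.
  set m := x ^ p * n ^ (p - 1) with hm
  have hnn : n⁻¹ = n ^ (p - 1) := by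
    rw [inv_eq_iff_mul_eq_one, ← pow_succ', Nat.sub_add_cancel (Nat.pos_of_ne_zero hp), h.n_pow]
  have hmc : m ∈ Subgroup.center G :=
    mul_mem h.xp_mem_center (pow_mem h.n_mem_center _)
  have hmc' := Subgroup.mem_center_iff.1 hmc
  have hxz (c : ℕ) : x * z ^ c = z ^ c * x * n ^ c := by
    simpa using pow_mul_pow_of_mul_eq h.xz h.zn.symm h.xn.symm c 1
  have hyz' : y * z = z * y * m := by
    rw [hm, ← hnn, ← mul_assoc, ← h.yz, mul_inv_cancel_right]
  have hyz (c : ℕ) : y * z ^ c = z ^ c * y * m ^ c := by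
    simpa using pow_mul_pow_of_mul_eq hyz' (hmc' z).symm (hmc' y).symm c 1
  refine mem_of_left_mul_mem (S := {g | ∃ c a b d : ℕ, g = z ^ c * x ^ a * y ^ b * n ^ d})
    h.gen (k := p ^ 2) (pow_ne_zero 2 hp) ?_ ⟨0, 0, 0, 0, by simp⟩ ?_ g
  · rintro t (rfl | rfl | rfl | rfl)
    · exact h.x_pow
    · rw [sq, pow_mul, h.y_pow, one_pow]
    · rw [sq, pow_mul, h.z_pow, one_pow]
    · rw [sq, pow_mul, h.n_pow, one_pow]
  · rintro t ht _ ⟨c, a, b, d, rfl⟩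
    rcases ht with rfl | rfl | rfl | rfl
    · refine ⟨c, a + 1, b, c + d, ?_⟩
      have hn' := Subgroup.mem_center_iff.1 (pow_mem h.n_mem_center c)
      calc t * (z ^ c * t ^ a * y ^ b * n ^ d) = (t * z ^ c) * t ^ a * y ^ b * n ^ d := by
            simp only [mul_assoc]
        _ = z ^ c * t * (t ^ a * y ^ b * n ^ c) * n ^ d := by
            rw [hxz, hn' (t ^ a * y ^ b)]; simp only [mul_assoc]
        _ = _ := by rw [pow_succ', pow_add]; simp only [mul_assoc]
    · refine ⟨c, a + p * c, b + 1, (p - 1) * c + d, ?_⟩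
      have hm' := Subgroup.mem_center_iff.1 (pow_mem hmc c)
      calc t * (z ^ c * x ^ a * t ^ b * n ^ d) = (t * z ^ c) * x ^ a * t ^ b * n ^ d := by
            simp only [mul_assoc]
        _ = z ^ c * (t * x ^ a * m ^ c) * t ^ b * n ^ d := by
            rw [hyz, mul_assoc (z ^ c) t, hm' t, hm' (t * x ^ a)]; simp only [mul_assoc]
        _ = z ^ c * x ^ a * ((t * x ^ (p * c)) * n ^ ((p - 1) * c)) * t ^ b * n ^ d := by
            rw [← (h.xy.pow_left a).eq, hm, ((h.xn.pow_left p).pow_right _).mul_pow, ← pow_mul,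
              ← pow_mul]
            simp only [mul_assoc]
        _ = z ^ c * x ^ a * x ^ (p * c) * t * (n ^ ((p - 1) * c) * t ^ b) * n ^ d := by
            rw [← (h.xy.pow_left _).eq]; simp only [mul_assoc]
        _ = _ := by
            rw [((h.yn.pow_left b).pow_right _).symm.eq, pow_succ', pow_add, pow_add]
            simp only [mul_assoc]
    · exact ⟨c + 1, a, b, d, by rw [pow_succ']; simp only [mul_assoc]⟩
    · refine ⟨c, a, b, d + 1, ?_⟩
      rw [← hnc, pow_succ]; simp only [mul_assoc]

/-- The normal form of the elements. -/
def normalForm (p : ℕ) (x y z n : G) (t : ZMod p × ZMod (p ^ 2) × ZMod p × ZMod p) : G :=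
  z ^ t.1.val * x ^ t.2.1.val * y ^ t.2.2.1.val * n ^ t.2.2.2.val

theorem normalForm_surjective (h : ClassTwoGen p x y z n) (hp : p ≠ 0) :
    Function.Surjective (normalForm p x y z n) := by
  intro g
  obtain ⟨c, a, b, d, rfl⟩ := h.mem_normalForm hp g
  refine ⟨(c, a, b, d), ?_⟩
  simp only [normalForm, pow_val_natCast h.x_pow, pow_val_natCast h.y_pow,
    pow_val_natCast h.z_pow, pow_val_natCast h.n_pow]

/-- In the quotient `G₁`, a subgroup avoiding `x ^ p` has order at most `p`. -/
theorem card_le_of_notMem [Finite G] (h : ClassTwoGen p x y z 1) (hp : p.Prime)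
    (hG : Nat.card G = p ^ 4) {H : Subgroup G} (hH : x ^ p ∉ H) : Nat.card H ≤ p := by
  by_contra! hlt
  have := Fact.mk hp
  have hcard := sq_le_card_of_lt hp hG hlt
  have hxc : x ∈ Subgroup.center G :=
    h.mem_center_of_commute (Commute.refl x) h.xy.symm
      (by have := h.xz; rw [mul_one] at this; exact this.symm)
      (Commute.one_left x)
  have hord : orderOf x = p ^ 2 := by
    refine orderOf_eq_prime_pow (n := 1) ?_ h.x_pow
    rw [pow_one]
    intro h0
    exact hH (h0 ▸ H.one_mem)
  -- Every nontrivial subgroup of the cyclic group `⟨x⟩` of order `p ^ 2` contains `x ^ p`.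
  have hdisj : Disjoint (Subgroup.zpowers x) H := by
    rw [Subgroup.disjoint_def]
    intro g hg hgH
    obtain ⟨k, rfl⟩ := (mem_powers_iff_mem_zpowers.2 hg)
    dsimp only at hgH ⊢
    by_contra hne
    refine hH (prime_pow_mem_of_pow_mem hp hgH h.x_pow fun ⟨j, hj⟩ => hne ?_)
    rw [hj, pow_mul, h.x_pow, one_pow]
  have hcompl : Subgroup.IsComplement' (Subgroup.zpowers x) H := by
    refine Subgroup.isComplement'_of_card_mul_and_disjoint (le_antisymm ?_ ?_) hdisj
    · have hinj : Function.Injective fun t : Subgroup.zpowers x × H => (t.1 : G) * t.2 :=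
        Subgroup.mul_injective_of_disjoint hdisj
      simpa only [Nat.card_prod] using Nat.card_le_card_of_injective _ hinj
    · rw [hG, Nat.card_zpowers, hord, show 4 = 2 + 2 from rfl, pow_add]
      exact Nat.mul_le_mul_left _ hcard
  -- Now `G = ⟨x⟩ H` with `x` central, so `x ^ p = [y, z]` equals a commutator of elements of `H`, a
  -- contradiction.
  obtain ⟨⟨⟨u, hu⟩, ⟨k, hk⟩⟩, huk⟩ := hcompl.2 y
  obtain ⟨⟨⟨v, hv⟩, ⟨l, hl⟩⟩, hvl⟩ := hcompl.2 z
  have hle : Subgroup.zpowers x ≤ Subgroup.center G := Subgroup.zpowers_le.2 hxc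
  have h1 := h.comm_yz
  rw [inv_one, mul_one] at h1
  apply hH
  rw [← h1, ← huk, ← hvl]
  change comm (u * k) (v * l) ∈ H
  rw [comm_mul_mul_of_mem_center (hle hu) (hle hv)]
  exact H.mul_mem (H.mul_mem (H.mul_mem (H.inv_mem hk) (H.inv_mem hl)) hk) hl

/-- If `x ^ p = 1`, the normal form leaves room for only `p ^ 3` elements. -/
theorem xp_ne_one [Finite G] (h : ClassTwoGen p x y z 1) (hp : p.Prime)
    (hG : Nat.card G = p ^ 4) : x ^ p ≠ 1 := by
  intro h0
  have := Fact.mk hp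
  have hsurj : Function.Surjective
      fun t : ZMod p × ZMod p × ZMod p => z ^ t.1.val * x ^ t.2.1.val * y ^ t.2.2.val := by
    intro g
    obtain ⟨c, a, b, d, rfl⟩ := h.mem_normalForm hp.ne_zero g
    refine ⟨(c, a, b), ?_⟩
    simp only [pow_val_natCast h0, pow_val_natCast h.y_pow, pow_val_natCast h.z_pow, one_pow,
      mul_one]
  have hle := Nat.card_le_card_of_surjective _ hsurj
  simp only [Nat.card_prod, Nat.card_zmod, hG] at hle
  have : p ^ 3 < p ^ 4 := Nat.pow_lt_pow_right hp.one_lt (by norm_num)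
  exact absurd hle (not_le.2 (by calc p * (p * p) = p ^ 3 := by ring
    _ < p ^ 4 := this))

theorem cube_le_minimalDegree [Finite G] (h : ClassTwoGen p x y z 1) (hp : p.Prime)
    (hG : Nat.card G = p ^ 4) : p ^ 3 ≤ minimalDegree G :=
  le_minimalDegree_of_forall_index (h.xp_ne_one hp hG) fun _ hH =>
    cube_le_index_of_card_le hp hG (h.card_le_of_notMem hp hG hH)

end ClassTwoGen

end ClassTwo

/-! ### The relations shared by `E₂`, `E₃`, `G₂` and `G₃`. -/

section ClassThree

/-- The relations common to `E₂`, `E₃`, `G₂`, `G₃`, in multiplied-out form. -/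
structure ClassThreeRel {G : Type*} [Group G] (p : ℕ) (x w z : G) : Prop where
  x_pow : x ^ p ^ 2 = 1
  w_pow : w ^ p = 1
  z_pow : z ^ p ^ 2 = 1
  xw : x * w = w * x * x ^ p
  xz : x * z = z * x * w
  wz : Commute w z

/-- Generators satisfying `ClassThreeRel`. -/
structure ClassThreeGen {G : Type*} [Group G] (p : ℕ) (x w z : G) : Prop
    extends ClassThreeRel p x w z where
  gen : Subgroup.closure {x, w, z} = ⊤

namespace ClassThreeRel

variable {G : Type*} [Group G] {p : ℕ} {x w z : G}

theorem xp_pow (h : ClassThreeRel p x w z) : (x ^ p) ^ p = 1 := by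
  rw [← pow_mul, ← sq, h.x_pow]

theorem zp_pow (h : ClassThreeRel p x w z) : (z ^ p) ^ p = 1 := by
  rw [← pow_mul, ← sq, h.z_pow]

theorem comm_xw (h : ClassThreeRel p x w z) : comm x w = x ^ p := by
  rw [comm, mul_assoc, h.xw]; group

theorem w_xp (h : ClassThreeRel p x w z) : Commute w (x ^ p) := by
  have h1 : SemiconjBy w (x * x ^ p) x := by
    change w * (x * x ^ p) = x * w
    rw [h.xw, mul_assoc]
  have h2 := h1.pow_right p
  rwa [(Commute.self_pow x p).mul_pow, h.xp_pow, mul_one] at h2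

theorem wx (h : ClassThreeRel p x w z) (hp : p ≠ 0) : w * x = x * w * (x ^ p) ^ (p - 1) := by
  rw [h.xw, mul_assoc _ (x ^ p), ← pow_succ', Nat.sub_add_cancel (Nat.pos_of_ne_zero hp), h.xp_pow,
    mul_one]

theorem wx_pow (h : ClassThreeRel p x w z) (hp : p ≠ 0) (a c : ℕ) :
    w ^ c * x ^ a = x ^ a * w ^ c * ((x ^ p) ^ (p - 1)) ^ (a * c) :=
  pow_mul_pow_of_mul_eq (h.wx hp) ((Commute.self_pow x p).symm.pow_left _)
    (h.w_xp.symm.pow_left _) a c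

theorem xz_pow (h : ClassThreeRel p x w z) (c : ℕ) : x * z ^ c = z ^ c * x * w ^ c := by
  induction c with
  | zero => simp
  | succ c ih =>
    calc x * z ^ (c + 1) = (x * z ^ c) * z := by rw [pow_succ, mul_assoc]
      _ = z ^ c * x * (w ^ c * z) := by rw [ih]; simp only [mul_assoc]
      _ = z ^ c * (x * z) * w ^ c := by rw [(h.wz.pow_left c).eq]; simp only [mul_assoc]
      _ = _ := by rw [h.xz, pow_succ, pow_succ']; simp only [mul_assoc]

/-- Conjugation by `z` takes `x w` to `x`. In `(x w) ^ p` the correction term is a power of `x ^ p`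
with exponent divisible by `p.choose 2`; for odd `p` this is a multiple of `p`, so the term vanishes
and `(x w) ^ p = x ^ p`. -/
theorem z_xp (h : ClassThreeRel p x w z) (hp : p.Prime) (hodd : Odd p) : Commute z (x ^ p) := by
  have h1 : SemiconjBy z (x * w) x := by
    change z * (x * w) = x * z
    rw [h.xz, mul_assoc]
  have h2 := h1.pow_right p
  obtain ⟨k, hk⟩ := hp.dvd_choose_self (k := 2) two_ne_zero
    (hp.two_le.lt_of_ne (by rintro rfl; exact absurd hodd (by decide)))
  rwa [mul_pow_of_mul_eq (h.wx hp.ne_zero) ((Commute.self_pow x p).symm.pow_left _)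
    (h.w_xp.symm.pow_left _), h.w_pow, mul_one, ← pow_mul, hk,
    show (p - 1) * (p * k) = p * ((p - 1) * k) by ring, pow_mul, h.xp_pow, one_pow, mul_one] at h2

theorem x_zp (h : ClassThreeRel p x w z) : Commute x (z ^ p) := by
  have := h.xz_pow p
  rwa [h.w_pow, mul_one] at this

end ClassThreeRel

namespace ClassThreeGen

variable {G : Type*} [Group G] {p : ℕ} {x w z : G}

theorem mem_center_of_commute (h : ClassThreeGen p x w z) {g : G} (hx : Commute x g)
    (hw : Commute w g) (hz : Commute z g) : g ∈ Subgroup.center G := by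
  have : Subgroup.closure {x, w, z} ≤ Subgroup.centralizer {g} := by
    rw [Subgroup.closure_le]
    rintro t (rfl | rfl | rfl) <;> rw [SetLike.mem_coe, Subgroup.mem_centralizer_singleton_iff]
    exacts [hx, hw, hz]
  rw [h.gen] at this
  rw [Subgroup.mem_center_iff]
  intro t
  exact Subgroup.mem_centralizer_singleton_iff.1 (this (Subgroup.mem_top t))

theorem xp_mem_center (h : ClassThreeGen p x w z) (hp : p.Prime) (hodd : Odd p) :
    x ^ p ∈ Subgroup.center G :=
  h.mem_center_of_commute (Commute.self_pow x p) h.w_xp (h.z_xp hp hodd)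

theorem zp_mem_center (h : ClassThreeGen p x w z) : z ^ p ∈ Subgroup.center G :=
  h.mem_center_of_commute h.x_zp (h.wz.pow_right p) (Commute.self_pow z p)

theorem mem_normalForm (h : ClassThreeGen p x w z) (hp : p ≠ 0) (g : G) :
    ∃ c a b : ℕ, g = z ^ c * x ^ a * w ^ b := by
  have hwv := h.w_xp.symm.pow_left (p - 1)
  have hv (k : ℕ) : ((x ^ p) ^ (p - 1)) ^ k = x ^ (p * (p - 1) * k) := by
    rw [← pow_mul, ← pow_mul, mul_assoc]
  refine mem_of_left_mul_mem (S := {g | ∃ c a b : ℕ, g = z ^ c * x ^ a * w ^ b})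
    h.gen (k := p ^ 2) (pow_ne_zero 2 hp) ?_ ⟨0, 0, 0, by simp⟩ ?_ g
  · rintro t (rfl | rfl | rfl)
    · exact h.x_pow
    · rw [sq, pow_mul, h.w_pow, one_pow]
    · exact h.z_pow
  · rintro t ht _ ⟨c, a, b, rfl⟩
    rcases ht with rfl | rfl | rfl
    · refine ⟨c, 1 + a + p * (p - 1) * (a * c), c + b, ?_⟩
      calc t * (z ^ c * t ^ a * w ^ b) = (t * z ^ c) * t ^ a * w ^ b := by simp only [mul_assoc]
        _ = z ^ c * t * (w ^ c * t ^ a) * w ^ b := by rw [h.xz_pow]; simp only [mul_assoc]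
        _ = z ^ c * t * t ^ a * ((t ^ p) ^ (p - 1)) ^ (a * c) * w ^ c * w ^ b := by
            rw [h.wx_pow hp, mul_assoc (t ^ a), ((hwv.pow_left (a * c)).pow_right c).symm.eq]
            simp only [mul_assoc]
        _ = _ := by rw [hv, pow_add, pow_add, pow_add, pow_one]; simp only [mul_assoc]
    · refine ⟨c, a + p * (p - 1) * a, 1 + b, ?_⟩
      have h1 := h.wx_pow hp a 1
      rw [pow_one, mul_one] at h1
      calc t * (z ^ c * x ^ a * t ^ b) = (t * z ^ c) * x ^ a * t ^ b := by simp only [mul_assoc]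
        _ = z ^ c * (t * x ^ a) * t ^ b := by rw [(h.wz.pow_right c).eq]; simp only [mul_assoc]
        _ = z ^ c * x ^ a * ((x ^ p) ^ (p - 1)) ^ a * t * t ^ b := by
            rw [h1, mul_assoc (x ^ a), (hwv.pow_left a).symm.eq]
            simp only [mul_assoc]
        _ = _ := by rw [hv, pow_add, pow_add, pow_one]; simp only [mul_assoc]
    · exact ⟨c + 1, a, b, by rw [pow_succ']; simp only [mul_assoc]⟩

/-- The normal form of the elements, the exponent of `z` being taken modulo `q`. -/
def normalForm (p q : ℕ) (x w z : G) (t : ZMod q × ZMod (p ^ 2) × ZMod p) : G :=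
  z ^ t.1.val * x ^ t.2.1.val * w ^ t.2.2.val

theorem normalForm_surjective (h : ClassThreeGen p x w z) (hp : p ≠ 0) :
    Function.Surjective (normalForm p (p ^ 2) x w z) := by
  intro g
  obtain ⟨c, a, b, rfl⟩ := h.mem_normalForm hp g
  refine ⟨(c, a, b), ?_⟩
  simp only [normalForm, pow_val_natCast h.x_pow, pow_val_natCast h.w_pow,
    pow_val_natCast h.z_pow]

section Quotient

variable {k : ℕ}

theorem normalForm_bijective [Finite G] (h : ClassThreeGen p x w z) (hz : z ^ p = (x ^ p) ^ k)
    (hp : p ≠ 0) (hG : Nat.card G = p ^ 4) : Function.Bijective (normalForm p p x w z) := by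
  have := NeZero.mk hp
  refine Function.Surjective.bijective_of_nat_card_le ?_ ?_
  · intro g
    obtain ⟨c, a, b, rfl⟩ := h.mem_normalForm hp g
    -- The part `z ^ (p * (c / p))` equals `x ^ (p * k * (c / p))` and is absorbed into the power of
    -- `x`.
    refine ⟨(c, ((p * k * (c / p) + a : ℕ) : ZMod (p ^ 2)), b), ?_⟩
    simp only [normalForm, pow_val_natCast h.x_pow, pow_val_natCast h.w_pow]
    congr 1
    rw [ZMod.val_natCast, pow_add, ← mul_assoc]
    congr 1
    rw [pow_mul, pow_mul, ← hz, ← pow_mul, ← pow_add, Nat.mod_add_div]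
  · rw [hG]
    simp only [Nat.card_prod, Nat.card_zmod]
    exact le_of_eq (by ring)

theorem dvd_of_pow_eq_pow [Finite G] (h : ClassThreeGen p x w z) (hz : z ^ p = (x ^ p) ^ k)
    (hp : p ≠ 0) (hG : Nat.card G = p ^ 4) {a b : ℕ} (hab : x ^ a = w ^ b) :
    p ^ 2 ∣ a ∧ p ∣ b := by
  have hinj := (h.normalForm_bijective hz hp hG).injective
  have : normalForm p p x w z (0, a, 0) = normalForm p p x w z (0, 0, b) := by
    simp only [normalForm, pow_val_natCast h.x_pow, pow_val_natCast h.w_pow, ZMod.val_zero,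
      pow_zero, one_mul, mul_one]
    exact hab
  have := hinj this
  simp only [Prod.mk.injEq, true_and] at this
  exact ⟨(ZMod.natCast_eq_zero_iff _ _).1 this.1, (ZMod.natCast_eq_zero_iff _ _).1 this.2.symm⟩

theorem xp_ne_one [Finite G] (h : ClassThreeGen p x w z) (hz : z ^ p = (x ^ p) ^ k)
    (hp : p.Prime) (hG : Nat.card G = p ^ 4) : x ^ p ≠ 1 := by
  intro h0
  have := (h.dvd_of_pow_eq_pow hz hp.ne_zero hG (a := p) (b := 0) (by simpa using h0)).1
  have := Nat.le_of_dvd hp.pos this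
  nlinarith [hp.two_le]

theorem w_ne_one [Finite G] (h : ClassThreeGen p x w z) (hz : z ^ p = (x ^ p) ^ k)
    (hp : p.Prime) (hG : Nat.card G = p ^ 4) : w ≠ 1 := by
  intro h0
  have := (h.dvd_of_pow_eq_pow hz hp.ne_zero hG (a := 0) (b := 1) (by simpa using h0.symm)).2
  exact hp.one_lt.ne' (Nat.dvd_one.1 this)

/-- The subgroup generated by `w` is core-free, of index `p ^ 3`. -/
theorem minimalDegree_le_cube [Finite G] (h : ClassThreeGen p x w z) (hz : z ^ p = (x ^ p) ^ k)
    (hp : p.Prime) (hG : Nat.card G = p ^ 4) : minimalDegree G ≤ p ^ 3 := by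
  have := Fact.mk hp
  have hidx : Nat.card (G ⧸ Subgroup.zpowers w) = p ^ 3 := by
    have h1 := (Subgroup.zpowers w).card_mul_index
    rw [hG, Nat.card_zpowers, orderOf_eq_prime h.w_pow (h.w_ne_one hz hp hG), pow_succ' p 3] at h1
    exact Nat.eq_of_mul_eq_mul_left hp.pos h1
  rw [← hidx]
  refine minimalDegree_le (MulAction.toPermHom G (G ⧸ Subgroup.zpowers w)) ?_
  rw [← MonoidHom.ker_eq_bot_iff, ← Subgroup.normalCore_eq_ker, Subgroup.eq_bot_iff_forall]
  intro g hg
  obtain ⟨b, rfl⟩ := mem_powers_iff_mem_zpowers.2 (Subgroup.normalCore_le _ hg)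
  dsimp only at hg ⊢
  -- This conjugate is `w ^ b * x ^ (p * (p - 1) * b)`, so that power of `x` lies in `⟨w⟩`; the
  -- normal form then forces `p ∣ b`.
  have h2 : x⁻¹ * w ^ b * x ∈ Subgroup.zpowers w := by
    simpa using Subgroup.normalCore_le _ (Subgroup.normalCore_normal _ |>.conj_mem _ hg x⁻¹)
  have h3 := h.wx_pow hp.ne_zero 1 b
  rw [pow_one, one_mul, ← pow_mul, ← pow_mul] at h3
  rw [mul_assoc, h3, mul_assoc, inv_mul_cancel_left,
    Subgroup.mul_mem_cancel_left _ (Subgroup.npow_mem_zpowers w b)] at h2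
  obtain ⟨j, hj⟩ := mem_powers_iff_mem_zpowers.2 h2
  have h4 := (h.dvd_of_pow_eq_pow hz hp.ne_zero hG hj.symm).1
  rw [sq] at h4
  have h5 := Nat.dvd_of_mul_dvd_mul_left hp.pos h4
  have hcop : Nat.Coprime p (p - 1) := by
    refine hp.coprime_iff_not_dvd.2 fun hd => ?_
    have := Nat.le_of_dvd (Nat.sub_pos_of_lt hp.one_lt) hd
    have := hp.pos
    omega
  obtain ⟨i, rfl⟩ := hcop.dvd_of_dvd_mul_left h5
  rw [pow_mul, h.w_pow, one_pow]

/-- In the quotients `G₂` and `G₃`, a subgroup avoiding `x ^ p` has order at most `p`. -/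
theorem card_le_of_notMem [Finite G] (h : ClassThreeGen p x w z) (hz : z ^ p = (x ^ p) ^ k)
    (hk : ¬ p ∣ k) (hp : p.Prime) (hodd : Odd p) (hG : Nat.card G = p ^ 4)
    (χ : G →* Multiplicative (ZMod p)) (hχx : χ x = Multiplicative.ofAdd 1) (hχw : χ w = 1)
    (hχz : χ z = 1) {H : Subgroup G} (hH : x ^ p ∉ H) : Nat.card H ≤ p := by
  by_contra! hlt
  have := Fact.mk hp
  have hcard := sq_le_card_of_lt hp hG hlt
  have hχ (c a b : ℕ) : χ (z ^ c * x ^ a * w ^ b) = 1 ↔ p ∣ a := by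
    rw [map_mul, map_mul, map_pow, map_pow, map_pow, hχx, hχw, hχz, one_pow, one_pow, one_mul,
      mul_one, ← ofAdd_nsmul, nsmul_one, ofAdd_eq_one, ZMod.natCast_eq_zero_iff]
  -- An element of `ker χ` is `z ^ c * x ^ (p * i) * w ^ b`, with `p`-th power `(x ^ p) ^ (k * c)`.
  -- As `H` avoids `x ^ p` and `p ∤ k`, this forces `p ∣ c`, and `z ^ c` is a power of `x ^ p`.
  have hker : ∀ g ∈ H, χ g = 1 → ∃ i b : ℕ, g = (x ^ p) ^ i * w ^ b := by
    intro g hg hg1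
    obtain ⟨c, a, b, rfl⟩ := h.mem_normalForm hp.ne_zero g
    obtain ⟨i, rfl⟩ := (hχ c a b).1 hg1
    have hzx : Commute (z ^ c) (x ^ (p * i)) := by
      rw [pow_mul]; exact ((h.z_xp hp hodd).pow_right i).pow_left c
    have hwx : Commute (w ^ b) (x ^ (p * i)) := by
      rw [pow_mul]; exact (h.w_xp.pow_right i).pow_left b
    have hwz : Commute (w ^ b) (z ^ c) := (h.wz.pow_left b).pow_right c
    have hpow : (z ^ c * x ^ (p * i) * w ^ b) ^ p = (x ^ p) ^ (k * c) := by
      rw [(hwz.symm.mul_left hwx.symm).mul_pow, hzx.mul_pow, ← pow_mul, ← pow_mul, ← pow_mul,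
        mul_comm b p, pow_mul w, h.w_pow, one_pow, mul_one, mul_comm c p, pow_mul z, hz,
        show p * i * p = p ^ 2 * i by ring, pow_mul x (p ^ 2), h.x_pow, one_pow, mul_one, ← pow_mul]
    have hc : p ∣ c := by
      by_contra hc
      refine hH (mem_of_pow_mem hp (k := k * c) (hpow ▸ H.pow_mem hg p) h.xp_pow fun hd => ?_)
      exact (hp.dvd_mul.1 hd).elim hk hc
    obtain ⟨c, rfl⟩ := hc
    exact ⟨k * c + i, b, by rw [pow_mul z, hz, pow_add, ← pow_mul, ← pow_mul, ← pow_mul]⟩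
  by_cases hcase : ∃ g ∈ H, χ g = 1 ∧ g ≠ 1
  · obtain ⟨g, hg, hg1, hne⟩ := hcase
    obtain ⟨i, b, rfl⟩ := hker g hg hg1
    have hb : ¬ p ∣ b := by
      rintro ⟨b, rfl⟩
      rw [pow_mul w, h.w_pow, one_pow, mul_one] at hg hne
      refine hH (mem_of_pow_mem hp hg h.xp_pow fun ⟨j, hj⟩ => hne ?_)
      rw [hj, pow_mul, h.xp_pow, one_pow]
    -- An element of `H` outside `ker χ` would have with `(x ^ p) ^ i * w ^ b` a commutator that is
    -- a nontrivial power of `x ^ p`.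
    have hall : ∀ g ∈ H, χ g = 1 := by
      intro g hg'
      obtain ⟨c, a, b', rfl⟩ := h.mem_normalForm hp.ne_zero g
      rw [hχ]
      by_contra ha
      set u := x ^ p with hu
      have huc : ∀ j (t : G), t * u ^ j = u ^ j * t := fun j =>
        Subgroup.mem_center_iff.1 (pow_mem (h.xp_mem_center hp hodd) j)
      have hwu : w ^ b * x ^ a = x ^ a * w ^ b * u ^ ((p - 1) * (a * b)) := by
        rw [pow_mul u]; exact h.wx_pow hp.ne_zero a b
      have hkey : (u ^ i * w ^ b) * (z ^ c * x ^ a * w ^ b') =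
          (z ^ c * x ^ a * w ^ b') * (u ^ i * w ^ b) * u ^ ((p - 1) * (a * b)) := by
        calc (u ^ i * w ^ b) * (z ^ c * x ^ a * w ^ b')
            = u ^ i * (w ^ b * z ^ c) * x ^ a * w ^ b' := by simp only [mul_assoc]
          _ = u ^ i * z ^ c * (w ^ b * x ^ a) * w ^ b' := by
              rw [((h.wz.pow_left b).pow_right c).eq]; simp only [mul_assoc]
          _ = u ^ i * z ^ c * x ^ a * w ^ b * (u ^ ((p - 1) * (a * b)) * w ^ b') := by
              rw [hwu]; simp only [mul_assoc]
          _ = u ^ i * (z ^ c * x ^ a * (w ^ b' * w ^ b)) * u ^ ((p - 1) * (a * b)) := by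
              rw [← huc _ (w ^ b'), ← pow_add, add_comm b', pow_add]; simp only [mul_assoc]
          _ = _ := by
              rw [← huc i (z ^ c * x ^ a * (w ^ b' * w ^ b)), ← huc i (w ^ b)]
              simp only [mul_assoc]
      refine hH (mem_of_pow_mem hp (k := (p - 1) * (a * b)) ?_ h.xp_pow fun hd => ?_)
      · rw [← H.mul_mem_cancel_left (H.mul_mem hg' hg), ← hkey]
        exact H.mul_mem hg hg'
      · rcases hp.dvd_mul.1 hd with hd | hd
        · have := Nat.le_of_dvd (Nat.sub_pos_of_lt hp.one_lt) hd
          have := hp.pos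
          omega
        · exact (hp.dvd_mul.1 hd).elim ha hb
    -- Thus `H` lies in a set of at most `p ^ 2` elements, equals it by counting, and so contains `x
    -- ^ p`.
    set S : Set G := Set.range fun t : ZMod p × ZMod p => (x ^ p) ^ t.1.val * w ^ t.2.val
    have hsub : (H : Set G) ⊆ S := by
      intro g hg
      obtain ⟨i, b, rfl⟩ := hker g hg (hall g hg)
      exact ⟨(i, b), by simp only [pow_val_natCast h.xp_pow, pow_val_natCast h.w_pow]⟩
    have hSc : S.ncard ≤ p ^ 2 := by
      refine (Nat.card_le_card_of_surjective _ Set.rangeFactorization_surjective).trans ?_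
      simp [sq]
    have heq : (H : Set G) = S := Set.eq_of_subset_of_ncard_le hsub (hSc.trans hcard)
    apply hH
    rw [← SetLike.mem_coe, heq]
    refine ⟨((1 : ℕ), (0 : ℕ)), ?_⟩
    simp only [pow_val_natCast h.xp_pow, pow_val_natCast h.w_pow, pow_one, pow_zero, mul_one]
  · push Not at hcase
    -- Here `H` meets `ker χ` trivially, so it embeds in `ℤ/p`.
    have hinj : Function.Injective (χ.comp H.subtype) := by
      rw [injective_iff_map_eq_one]
      rintro ⟨g, hg⟩ hg1
      exact Subtype.ext (hcase g hg hg1)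
    have hle := Nat.card_le_card_of_injective _ hinj
    rw [Nat.card_congr Multiplicative.toAdd, Nat.card_zmod] at hle
    exact absurd hle (not_le.2 hlt)

theorem minimalDegree_eq_cube [Finite G] (h : ClassThreeGen p x w z) (hz : z ^ p = (x ^ p) ^ k)
    (hk : ¬ p ∣ k) (hp : p.Prime) (hodd : Odd p) (hG : Nat.card G = p ^ 4)
    (χ : G →* Multiplicative (ZMod p)) (hχx : χ x = Multiplicative.ofAdd 1) (hχw : χ w = 1)
    (hχz : χ z = 1) : minimalDegree G = p ^ 3 :=
  le_antisymm (h.minimalDegree_le_cube hz hp hG) <|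
    le_minimalDegree_of_forall_index (h.xp_ne_one hz hp hG) fun _ hH =>
      cube_le_index_of_card_le hp hG (h.card_le_of_notMem hz hk hp hodd hG χ hχx hχw hχz hH)

end Quotient

end ClassThreeGen

end ClassThree

/-! ### Permutation models on `ℤ/p²` and `(ℤ/p)²`. -/

section Models

open Polynomial

variable {p : ℕ}

theorem natCast_mul_self_zmod_sq (p : ℕ) : (p : ZMod (p ^ 2)) * p = 0 := by
  rw [← Nat.cast_mul, ← sq, ZMod.natCast_self]

/-- Modulo `p` the value of `q` does not change under `a ↦ a + p b`. Hence the maps `a ↦ a + p q(a)`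
compose by adding polynomials: they commute and have `p`-th power `1`. -/
theorem natCast_mul_eval_add (q : (ZMod (p ^ 2))[X]) (a b : ZMod (p ^ 2)) :
    (p : ZMod (p ^ 2)) * q.eval (a + (p : ZMod (p ^ 2)) * b) =
      (p : ZMod (p ^ 2)) * q.eval a := by
  obtain ⟨c, hc⟩ := sub_dvd_eval_sub (a + (p : ZMod (p ^ 2)) * b) a q
  linear_combination (p : ZMod (p ^ 2)) * hc + b * c * natCast_mul_self_zmod_sq p

/-- The permutation `a ↦ a + p q(a)` of `ℤ/p²`. -/
def polyShift (q : (ZMod (p ^ 2))[X]) : Equiv.Perm (ZMod (p ^ 2)) where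
  toFun a := a + p * q.eval a
  invFun a := a - p * q.eval a
  left_inv a := by
    change a + p * q.eval a - p * q.eval (a + p * q.eval a) = a
    rw [natCast_mul_eval_add, add_sub_cancel_right]
  right_inv a := by
    change a - p * q.eval a + p * q.eval (a - p * q.eval a) = a
    rw [sub_eq_add_neg, ← mul_neg, natCast_mul_eval_add, mul_neg, neg_add_cancel_right]

theorem polyShift_apply (q : (ZMod (p ^ 2))[X]) (a : ZMod (p ^ 2)) :
    polyShift q a = a + p * q.eval a := rfl

theorem polyShift_mul (q r : (ZMod (p ^ 2))[X]) :
    polyShift q * polyShift r = polyShift (q + r) := by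
  ext1 a
  rw [Equiv.Perm.mul_apply, polyShift_apply, polyShift_apply, polyShift_apply,
    natCast_mul_eval_add, eval_add]
  ring

theorem polyShift_pow (q : (ZMod (p ^ 2))[X]) (k : ℕ) : polyShift q ^ k = polyShift (k • q) := by
  induction k with
  | zero => ext1 a; simp [polyShift_apply]
  | succ k ih => rw [_root_.pow_succ (polyShift q) k, ih, polyShift_mul, succ_nsmul]

theorem polyShift_pow_self (q : (ZMod (p ^ 2))[X]) : polyShift q ^ p = 1 := by
  ext1 a
  rw [polyShift_pow, polyShift_apply, eval_smul, nsmul_eq_mul, ← mul_assoc,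
    natCast_mul_self_zmod_sq, zero_mul, add_zero, Equiv.Perm.one_apply]

theorem addRight_one_pow_apply {q : ℕ} (k : ℕ) (a : ZMod q) :
    ((Equiv.addRight (1 : ZMod q)) ^ k) a = a + k := by
  induction k generalizing a with
  | zero => simp
  | succ k ih =>
    rw [pow_succ, Equiv.Perm.mul_apply, ih, Equiv.coe_addRight]
    push_cast; ring

theorem addRight_one_pow_self (q : ℕ) : (Equiv.addRight (1 : ZMod q)) ^ q = 1 := by
  ext1 a
  rw [addRight_one_pow_apply, ZMod.natCast_self, add_zero, Equiv.Perm.one_apply]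

/-- Multiplication by `p` on `ℤ/p²` has kernel `p ℤ/p²`, so a multiple of `p` there determines its
cofactor modulo `p`. -/
theorem natCast_injOn_of_mul {m n : ℕ} (hp : p ≠ 0)
    (h : (p : ZMod (p ^ 2)) * m = p * n) : (m : ZMod p) = n := by
  rw [← Nat.cast_mul, ← Nat.cast_mul, ZMod.natCast_eq_natCast_iff, sq] at h
  exact (ZMod.natCast_eq_natCast_iff _ _ _).2 (Nat.ModEq.mul_left_cancel' hp h)

/-- The image of `x` in the permutation model of `E₂` and `E₃`. -/
def modelX (p : ℕ) : Equiv.Perm (ZMod (p ^ 2)) × Multiplicative (ZMod (p ^ 2)) :=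
  (Equiv.addRight 1, 1)

/-- The image of `[x, z]` in the permutation model of `E₂` and `E₃`. -/
noncomputable def modelW (p : ℕ) : Equiv.Perm (ZMod (p ^ 2)) × Multiplicative (ZMod (p ^ 2)) :=
  (polyShift (-X), 1)

/-- The image of `z` in the permutation model of `E₂` and `E₃`. -/
noncomputable def modelZ (p : ℕ) : Equiv.Perm (ZMod (p ^ 2)) × Multiplicative (ZMod (p ^ 2)) :=
  -- For odd `p` the constant is the inverse of `2`, so the polynomial is the binomial `X(X-1)/2`.
  -- Its forward difference is `X` and that of `X` is `1`; this yields `[x, z] = w` and `[x, w] = x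
  -- ^ p`. The second coordinate keeps `z ^ p` independent of `x ^ p`.
  (polyShift (C (((p ^ 2 + 1) / 2 : ℕ) : ZMod (p ^ 2)) * (X * (X - 1))), Multiplicative.ofAdd 1)

theorem two_mul_half (hodd : Odd p) :
    2 * (((p ^ 2 + 1) / 2 : ℕ) : ZMod (p ^ 2)) = 1 := by
  have h2 : 2 * ((p ^ 2 + 1) / 2) = p ^ 2 + 1 :=
    Nat.mul_div_cancel' (hodd.pow.add_one).two_dvd
  have := congrArg (Nat.cast : ℕ → ZMod (p ^ 2)) h2
  rwa [Nat.cast_mul, Nat.cast_add, ZMod.natCast_self, zero_add, Nat.cast_one, Nat.cast_ofNat]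
    at this

theorem classThreeRel_model (hodd : Odd p) :
    ClassThreeRel p (modelX p) (modelW p) (modelZ p) where
  x_pow := Prod.ext (addRight_one_pow_self _) (one_pow _)
  w_pow := Prod.ext (polyShift_pow_self _) (one_pow _)
  z_pow := by
    refine Prod.ext ?_ ?_
    · change polyShift _ ^ p ^ 2 = 1
      refine (congrArg (polyShift _ ^ ·) (sq p)).trans ?_
      rw [pow_mul, polyShift_pow_self, one_pow]
    · change Multiplicative.ofAdd (1 : ZMod (p ^ 2)) ^ p ^ 2 = 1
      rw [← ofAdd_nsmul, nsmul_one, ZMod.natCast_self, ofAdd_zero]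
  xw := by
    refine Prod.ext (Equiv.ext fun a => ?_) ?_
    · change polyShift (-X) a + 1 = polyShift (-X) (((Equiv.addRight 1) ^ p) a + 1)
      rw [addRight_one_pow_apply, polyShift_apply, polyShift_apply]
      simp only [eval_neg, eval_X]
      linear_combination natCast_mul_self_zmod_sq p
    · simp [modelX, modelW]
  xz := by
    refine Prod.ext (Equiv.ext fun a => ?_) ?_
    · change polyShift _ a + 1 = polyShift _ (polyShift (-X) a + 1)
      rw [polyShift_apply, polyShift_apply, polyShift_apply]
      simp only [eval_neg, eval_X, eval_mul, eval_C, eval_sub, eval_one]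
      set h := (((p ^ 2 + 1) / 2 : ℕ) : ZMod (p ^ 2))
      linear_combination (-p * a) * two_mul_half hodd +
        (h * a * (2 * a + 1 - p * a)) * natCast_mul_self_zmod_sq p
    · simp [modelX, modelW, modelZ]
  wz := by
    refine Prod.ext ?_ ?_
    · change polyShift _ * polyShift _ = polyShift _ * polyShift _
      rw [polyShift_mul, polyShift_mul, add_comm]
    · simp [modelW, modelZ]

theorem model_normalForm_injective (hp : p ≠ 0) : Function.Injective
    (ClassThreeGen.normalForm p (p ^ 2) (modelX p) (modelW p) (modelZ p)) := by
  have := NeZero.mk hp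
  rintro ⟨c, a, b⟩ ⟨c', a', b'⟩ h
  have h2 (c a : ZMod (p ^ 2)) (b : ZMod p) :
      (ClassThreeGen.normalForm p (p ^ 2) (modelX p) (modelW p) (modelZ p) (c, a, b)).2 =
        Multiplicative.ofAdd c := by
    simp [ClassThreeGen.normalForm, modelX, modelW, modelZ, ← ofAdd_nsmul]
  -- The second coordinate reads off `c`. After cancelling the power of `z`, the value at `0` gives
  -- `a` and the value at `1` gives `p * b`.
  obtain rfl : c = c' := Multiplicative.ofAdd.injective
    ((h2 c a b).symm.trans ((congrArg Prod.snd h).trans (h2 c' a' b')))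
  simp only [ClassThreeGen.normalForm, mul_assoc, mul_right_inj] at h
  have h1 (t : ZMod (p ^ 2)) : t + (p : ZMod (p ^ 2)) * ((b.val : ZMod (p ^ 2)) * -t) + a =
      t + (p : ZMod (p ^ 2)) * ((b'.val : ZMod (p ^ 2)) * -t) + a' := by
    have := DFunLike.congr_fun (congrArg Prod.fst h) t
    change ((Equiv.addRight 1) ^ a.val) ((polyShift (-X) ^ b.val) t) =
      ((Equiv.addRight 1) ^ a'.val) ((polyShift (-X) ^ b'.val) t) at this
    rw [addRight_one_pow_apply, addRight_one_pow_apply, polyShift_pow, polyShift_pow,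
      polyShift_apply, polyShift_apply, eval_smul, eval_smul, nsmul_eq_mul, nsmul_eq_mul,
      eval_neg, eval_X, ZMod.natCast_zmod_val, ZMod.natCast_zmod_val] at this
    exact this
  obtain rfl : a = a' := by simpa using h1 0
  have h3 : (p : ZMod (p ^ 2)) * b.val = p * b'.val := by linear_combination -h1 1
  have h4 := natCast_injOn_of_mul hp h3
  rw [ZMod.natCast_zmod_val, ZMod.natCast_zmod_val] at h4
  rw [h4]

/-- The permutation `(c, d) ↦ (c, d + f(c))` of `(ℤ/p)²`. -/
def shear (f : ZMod p → ZMod p) : Equiv.Perm (ZMod p × ZMod p) where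
  toFun t := (t.1, t.2 + f t.1)
  invFun t := (t.1, t.2 - f t.1)
  left_inv t := by simp
  right_inv t := by simp

theorem shear_mul (f g : ZMod p → ZMod p) : shear f * shear g = shear (f + g) := by
  ext1 t
  refine Prod.ext rfl ?_
  change t.2 + g t.1 + f t.1 = t.2 + (f t.1 + g t.1)
  ring

theorem shear_pow (f : ZMod p → ZMod p) (k : ℕ) : shear f ^ k = shear (k • f) := by
  induction k with
  | zero =>
    ext1 t
    exact Prod.ext rfl (by simp [shear])
  | succ k ih => rw [pow_succ, ih, shear_mul, succ_nsmul]

theorem shear_pow_apply (f : ZMod p → ZMod p) (k : ℕ) (t : ZMod p × ZMod p) :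
    (shear f ^ k) t = (t.1, t.2 + k * f t.1) := by
  rw [shear_pow]
  exact Prod.ext rfl (by simp [shear])

theorem shear_pow_self (f : ZMod p → ZMod p) : shear f ^ p = 1 := by
  ext1 t
  rw [shear_pow_apply]
  simp

/-- The permutation `(c, d) ↦ (c + 1, d)` of `(ℤ/p)²`. -/
def shiftFst (p : ℕ) : Equiv.Perm (ZMod p × ZMod p) :=
  Equiv.prodCongr (Equiv.addRight 1) (Equiv.refl _)

theorem shiftFst_pow_apply (k : ℕ) (t : ZMod p × ZMod p) :
    (shiftFst p ^ k) t = (t.1 + k, t.2) := by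
  induction k generalizing t with
  | zero => simp
  | succ k ih =>
    rw [pow_succ, Equiv.Perm.mul_apply, ih]
    refine Prod.ext ?_ rfl
    change t.1 + 1 + k = t.1 + (k + 1 : ℕ)
    push_cast; ring

/-- The image of `x` in the permutation model of `E₁`. -/
def heisX (p : ℕ) : Equiv.Perm (ZMod p × ZMod p) × Equiv.Perm (ZMod (p ^ 2)) :=
  (shear id, Equiv.addRight 1)

/-- The image of `y` in the permutation model of `E₁`. -/
def heisY (p : ℕ) : Equiv.Perm (ZMod p × ZMod p) × Equiv.Perm (ZMod (p ^ 2)) :=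
  (shear (-id), 1)

/-- The image of `z` in the permutation model of `E₁`. -/
noncomputable def heisZ (p : ℕ) : Equiv.Perm (ZMod p × ZMod p) × Equiv.Perm (ZMod (p ^ 2)) :=
  (shiftFst p, polyShift (-X))

/-- The image of `n` in the permutation model of `E₁`. -/
noncomputable def heisN (p : ℕ) : Equiv.Perm (ZMod p × ZMod p) × Equiv.Perm (ZMod (p ^ 2)) :=
  (shear 1, polyShift 1)

theorem addRight_one_pow_eq_polyShift :
    (Equiv.addRight (1 : ZMod (p ^ 2))) ^ p = polyShift 1 := by
  ext1 a
  rw [addRight_one_pow_apply, polyShift_apply, eval_one, mul_one]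

theorem classTwoRel_model :
    ClassTwoRel p (heisX p) (heisY p) (heisZ p) (heisN p) where
  x_pow := by
    refine Prod.ext ?_ (addRight_one_pow_self _)
    change shear id ^ p ^ 2 = 1
    rw [sq, pow_mul, shear_pow_self, one_pow]
  y_pow := Prod.ext (shear_pow_self _) (one_pow _)
  z_pow := by
    refine Prod.ext (Equiv.ext fun t => ?_) (polyShift_pow_self _)
    change (shiftFst p ^ p) t = t
    rw [shiftFst_pow_apply]
    simp
  n_pow := Prod.ext (shear_pow_self _) (polyShift_pow_self _)
  yz := by
    refine Prod.ext (Equiv.ext fun t => ?_) ?_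
    · change (shear (-id) * shiftFst p * shear 1 : Equiv.Perm (ZMod p × ZMod p)) t =
        (shiftFst p * shear (-id) * shear id ^ p : Equiv.Perm (ZMod p × ZMod p)) t
      rw [shear_pow_self]
      refine Prod.ext rfl ?_
      change t.2 + 1 + -(t.1 + 1) = t.2 + - t.1
      ring
    · change 1 * polyShift (-X) * polyShift 1 = polyShift (-X) * 1 * (Equiv.addRight 1) ^ p
      rw [addRight_one_pow_eq_polyShift, one_mul, mul_one]
  xz := by
    refine Prod.ext (Equiv.ext fun t => ?_) (Equiv.ext fun a => ?_)
    · refine Prod.ext rfl ?_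
      change t.2 + (t.1 + 1) = t.2 + 1 + t.1
      ring
    · change polyShift (-X) a + 1 = polyShift (-X) (polyShift 1 a + 1)
      rw [polyShift_apply, polyShift_apply, polyShift_apply]
      simp only [eval_neg, eval_X, eval_one]
      linear_combination natCast_mul_self_zmod_sq p
  xy := by
    refine Prod.ext ?_ ?_
    · change shear _ * shear _ = shear _ * shear _
      rw [shear_mul, shear_mul, add_comm]
    · simp [heisX, heisY]
  xn := by
    refine Prod.ext ?_ ?_
    · change shear _ * shear _ = shear _ * shear _
      rw [shear_mul, shear_mul, add_comm]
    · change Equiv.addRight 1 * polyShift 1 = polyShift 1 * Equiv.addRight 1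
      rw [← addRight_one_pow_eq_polyShift, (Commute.self_pow _ _).eq]
  yn := by
    refine Prod.ext ?_ ?_
    · change shear _ * shear _ = shear _ * shear _
      rw [shear_mul, shear_mul, add_comm]
    · simp [heisY, heisN]
  zn := by
    refine Prod.ext (Equiv.ext fun t => rfl) ?_
    change polyShift _ * polyShift _ = polyShift _ * polyShift _
    rw [polyShift_mul, polyShift_mul, add_comm]

theorem heis_normalForm_injective (hp : p ≠ 0) : Function.Injective
    (ClassTwoGen.normalForm p (heisX p) (heisY p) (heisZ p) (heisN p)) := by
  have := NeZero.mk hp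
  rintro ⟨c, a, b, d⟩ ⟨c', a', b', d'⟩ h
  have h1 (c : ZMod p) (a : ZMod (p ^ 2)) (b d : ZMod p) (t : ZMod p × ZMod p) :
      (ClassTwoGen.normalForm p (heisX p) (heisY p) (heisZ p) (heisN p) (c, a, b, d)).1 t =
        (t.1 + c, t.2 + d + b * -t.1 + a.val * t.1) := by
    change (shiftFst p ^ c.val) ((shear id ^ a.val) ((shear (-id) ^ b.val)
      ((shear 1 ^ d.val) t))) = _
    rw [shear_pow_apply, shear_pow_apply, shear_pow_apply, shiftFst_pow_apply]
    simp
  have h2 := (h1 c a b d (0, 0)).symm.trans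
    ((DFunLike.congr_fun (congrArg Prod.fst h) _).trans (h1 c' a' b' d' (0, 0)))
  simp only [zero_add, neg_zero, mul_zero, add_zero, Prod.mk.injEq] at h2
  obtain ⟨rfl, rfl⟩ := h2
  -- The point `(0, 0)` has given `c` and `d`. The point `(1, 0)` yields `a - b` modulo `p`, which
  -- determines `b` once the action on `ℤ/p²` has given `a`.
  have h3 := (h1 c a b d (1, 0)).symm.trans
    ((DFunLike.congr_fun (congrArg Prod.fst h) _).trans (h1 c a' b' d (1, 0)))
  simp only [ClassTwoGen.normalForm, mul_right_inj, mul_assoc] at h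
  simp only [← mul_assoc, mul_left_inj] at h
  have h4 := DFunLike.congr_fun (congrArg Prod.snd h) 0
  change ((Equiv.addRight (1 : ZMod (p ^ 2))) ^ a.val)
    (((1 : Equiv.Perm (ZMod (p ^ 2))) ^ b.val) 0) = ((Equiv.addRight (1 : ZMod (p ^ 2))) ^ a'.val)
    (((1 : Equiv.Perm (ZMod (p ^ 2))) ^ b'.val) 0) at h4
  rw [one_pow, one_pow, Equiv.Perm.one_apply, addRight_one_pow_apply, addRight_one_pow_apply,
    ZMod.natCast_zmod_val, ZMod.natCast_zmod_val, zero_add, zero_add] at h4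
  subst h4
  simp only [Prod.mk.injEq, mul_one, add_left_inj, add_right_inj, mul_neg, neg_inj, true_and] at h3
  rw [h3]

end Models

/-! ### Orders and minimal degrees from the models; distinguished quotients. -/

section Abstract

variable {p : ℕ}

/-- The minimal degree and order of a group with the normal form of `E₂` and `E₃` that maps to
the permutation model. -/
theorem ClassThreeGen.card_and_minimalDegree {E : Type*} [Group E] {x w z : E}
    (h : ClassThreeGen p x w z) (hp : p.Prime) (hodd : Odd p)
    (φ : E →* Equiv.Perm (ZMod (p ^ 2)) × Multiplicative (ZMod (p ^ 2)))
    (hx : φ x = modelX p) (hw : φ w = modelW p) (hz : φ z = modelZ p) :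
    Nat.card E = p ^ 5 ∧ minimalDegree E = 2 * p ^ 2 := by
  have := NeZero.mk hp.ne_zero
  have := Fact.mk hp
  have hcomp : φ ∘ normalForm p (p ^ 2) x w z =
      normalForm p (p ^ 2) (modelX p) (modelW p) (modelZ p) := by
    ext1 t
    simp only [Function.comp_apply, normalForm, map_mul, map_pow, hx, hw, hz]
  have hsurj := h.normalForm_surjective hp.ne_zero
  have hcinj : Function.Injective (φ ∘ normalForm p (p ^ 2) x w z) := by
    rw [hcomp]; exact model_normalForm_injective hp.ne_zero
  have hinj : Function.Injective φ := by
    intro g g' hgg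
    obtain ⟨t, rfl⟩ := hsurj g
    obtain ⟨t', rfl⟩ := hsurj g'
    rw [hcinj hgg]
  have hbij : Function.Bijective (normalForm p (p ^ 2) x w z) := ⟨hcinj.of_comp, hsurj⟩
  have hcard : Nat.card E = p ^ 5 := by
    rw [← Nat.card_congr (Equiv.ofBijective _ hbij)]
    simp only [Nat.card_prod, Nat.card_zmod]
    ring
  have : Finite E := Nat.finite_of_card_ne_zero (hcard ▸ pow_ne_zero 5 hp.ne_zero)
  have hG : IsPGroup p E := IsPGroup.of_card hcard
  have hZ1 : ((modelZ p) ^ p).1 = 1 := polyShift_pow_self _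
  have hp0 : (p : ZMod (p ^ 2)) ≠ 0 := by
    rw [Ne, ZMod.natCast_eq_zero_iff]
    intro hd
    have := Nat.le_of_dvd hp.pos hd
    nlinarith [hp.two_le]
  have hxp : x ^ p ≠ 1 := by
    intro h0
    have h1 := DFunLike.congr_fun (congrArg Prod.fst (congrArg φ h0)) 0
    rw [map_pow, hx, map_one] at h1
    change ((Equiv.addRight (1 : ZMod (p ^ 2))) ^ p) 0 = 0 at h1
    rw [addRight_one_pow_apply, zero_add] at h1
    exact hp0 h1
  have hzp : z ^ p ≠ 1 := by
    intro h0
    have h1 := congrArg Prod.snd (congrArg φ h0)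
    rw [map_pow, hz, map_one] at h1
    change Multiplicative.ofAdd (1 : ZMod (p ^ 2)) ^ p = 1 at h1
    rw [← ofAdd_nsmul, nsmul_one, ofAdd_eq_one] at h1
    exact hp0 h1
  refine ⟨hcard, le_antisymm ?_ ?_⟩
  -- Letting the cyclic factor act regularly on itself turns the model into an action on `p ^ 2 + p
  -- ^ 2` points.
  · let ψ := (Equiv.Perm.sumCongrHom (ZMod (p ^ 2)) (Multiplicative (ZMod (p ^ 2)))).comp
      ((MonoidHom.prodMap (MonoidHom.id _)
        (MulAction.toPermHom (Multiplicative (ZMod (p ^ 2))) _)).comp φ)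
    have hprod : Function.Injective (MonoidHom.prodMap (MonoidHom.id (Equiv.Perm (ZMod (p ^ 2))))
        (MulAction.toPermHom (Multiplicative (ZMod (p ^ 2))) (Multiplicative (ZMod (p ^ 2))))) :=
      Function.Injective.prodMap Function.injective_id MulAction.toPerm_injective
    have hψ : Function.Injective ψ :=
      Equiv.Perm.sumCongrHom_injective.comp (hprod.comp hinj)
    refine (minimalDegree_le ψ hψ).trans ?_
    rw [Nat.card_sum, Nat.card_congr Multiplicative.toAdd, Nat.card_zmod, two_mul]
  · refine two_mul_sq_le_minimalDegree hp hG (Subgroup.closure {x ^ p, z ^ p}) ?_ ?_ ?_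
      (g := x) (g' := w) (h.comm_xw ▸ hxp)
    · rw [Subgroup.closure_le]
      rintro t (rfl | rfl)
      exacts [h.xp_mem_center hp hodd, h.zp_mem_center]
    · refine sq_le_card_of_disjoint_zpowers hp h.xp_pow h.zp_pow hxp hzp ?_
      rw [Subgroup.disjoint_def]
      rintro g ⟨i, rfl⟩ ⟨j, hj⟩
      dsimp only at hj ⊢
      refine hinj (Prod.ext ?_ ?_)
      -- `z ^ p` is trivial in the first coordinate and `x ^ p` in the second, so a common power is
      -- trivial in both.
      · rw [← hj, map_zpow, map_pow, hz, map_one, Prod.pow_fst, hZ1, one_zpow, Prod.fst_one]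
      · rw [map_zpow, map_pow, hx, map_one, Prod.pow_snd, Prod.pow_snd]
        simp [modelX]
    · intro H hH
      rw [Subgroup.closure_le]
      rintro t (rfl | rfl) <;> exact pow_mem_of_index_eq_prime hp hG hH _

/-- The minimal degree and order of a group with the normal form of `E₁` that maps to
the permutation model. -/
theorem ClassTwoGen.card_and_minimalDegree {E : Type*} [Group E] {x y z n : E}
    (h : ClassTwoGen p x y z n) (hp : p.Prime)
    (φ : E →* Equiv.Perm (ZMod p × ZMod p) × Equiv.Perm (ZMod (p ^ 2)))
    (hx : φ x = heisX p) (hy : φ y = heisY p) (hz : φ z = heisZ p) (hn : φ n = heisN p) :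
    Nat.card E = p ^ 5 ∧ minimalDegree E = 2 * p ^ 2 ∧ n ≠ 1 := by
  have := NeZero.mk hp.ne_zero
  have := Fact.mk hp
  have hcomp : φ ∘ normalForm p x y z n =
      normalForm p (heisX p) (heisY p) (heisZ p) (heisN p) := by
    ext1 t
    simp only [Function.comp_apply, normalForm, map_mul, map_pow, hx, hy, hz, hn]
  have hsurj := h.normalForm_surjective hp.ne_zero
  have hcinj : Function.Injective (φ ∘ normalForm p x y z n) := by
    rw [hcomp]; exact heis_normalForm_injective hp.ne_zero
  have hinj : Function.Injective φ := by
    intro g g' hgg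
    obtain ⟨t, rfl⟩ := hsurj g
    obtain ⟨t', rfl⟩ := hsurj g'
    rw [hcinj hgg]
  have hbij : Function.Bijective (normalForm p x y z n) := ⟨hcinj.of_comp, hsurj⟩
  have hcard : Nat.card E = p ^ 5 := by
    rw [← Nat.card_congr (Equiv.ofBijective _ hbij)]
    simp only [Nat.card_prod, Nat.card_zmod]
    ring
  have : Finite E := Nat.finite_of_card_ne_zero (hcard ▸ pow_ne_zero 5 hp.ne_zero)
  have hG : IsPGroup p E := IsPGroup.of_card hcard
  have hX1 : ((heisX p) ^ p).1 = 1 := shear_pow_self _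
  -- On `(ℤ/p)²` the element `n` is a translation of order `p` while `x ^ p` acts trivially, so this
  -- coordinate separates `⟨n⟩` from `⟨x ^ p⟩`.
  have hnpow (k : ℕ) (hk : (φ (n ^ k)).1 = 1) : p ∣ k := by
    rw [map_pow, hn] at hk
    have h1 := congrArg Prod.snd (DFunLike.congr_fun hk ((0 : ZMod p), (0 : ZMod p)))
    change ((shear (1 : ZMod p → ZMod p) ^ k) (0, 0)).2 = 0 at h1
    rw [shear_pow_apply] at h1
    simpa [ZMod.natCast_eq_zero_iff] using h1
  have hn1 : n ≠ 1 := by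
    intro h0
    have := hnpow 1 (by rw [pow_one, h0, map_one, Prod.fst_one])
    exact hp.one_lt.ne' (Nat.dvd_one.1 this)
  have hxp : x ^ p ≠ 1 := by
    intro h0
    have h1 := DFunLike.congr_fun (congrArg Prod.snd (congrArg φ h0)) 0
    rw [map_pow, hx, map_one] at h1
    change ((Equiv.addRight (1 : ZMod (p ^ 2))) ^ p) 0 = 0 at h1
    rw [addRight_one_pow_apply, zero_add, ZMod.natCast_eq_zero_iff] at h1
    have := Nat.le_of_dvd hp.pos h1
    nlinarith [hp.two_le]
  refine ⟨hcard, le_antisymm ?_ ?_, hn1⟩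
  · refine (minimalDegree_le ((Equiv.Perm.sumCongrHom (ZMod p × ZMod p) (ZMod (p ^ 2))).comp φ)
      (Equiv.Perm.sumCongrHom_injective.comp hinj)).trans ?_
    rw [Nat.card_sum, Nat.card_prod, Nat.card_zmod, Nat.card_zmod, two_mul, sq]
  · refine two_mul_sq_le_minimalDegree hp hG (Subgroup.closure {x ^ p, n}) ?_ ?_ ?_
      (g := x) (g' := z) (h.comm_xz ▸ hn1)
    · rw [Subgroup.closure_le]
      rintro t (rfl | rfl)
      exacts [h.xp_mem_center, h.n_mem_center]
    · refine sq_le_card_of_disjoint_zpowers hp h.xp_pow h.n_pow hxp hn1 ?_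
      rw [Subgroup.disjoint_def]
      rintro g ⟨i, rfl⟩ hg
      obtain ⟨j, hj⟩ := mem_powers_iff_mem_zpowers.2 hg
      dsimp only at hj ⊢
      obtain ⟨k, rfl⟩ := hnpow j (by
        rw [hj, map_zpow, map_pow, hx, Prod.pow_fst, hX1, one_zpow])
      rw [← hj, pow_mul, h.n_pow, one_pow]
    · intro H hH
      rw [Subgroup.closure_le]
      rintro t (rfl | rfl)
      · exact pow_mem_of_index_eq_prime hp hG hH _
      · rw [← h.comm_xz]
        exact comm_mem_of_index_eq_prime hp hG hH _ _

theorem normal_zpowers_of_mem_center {E : Type*} [Group E] {n : E}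
    (hn : n ∈ Subgroup.center E) : (Subgroup.zpowers n).Normal where
  conj_mem t ht g := by
    rwa [Subgroup.mem_center_iff.1 (Subgroup.zpowers_le.2 hn ht) g, mul_inv_cancel_right]

/-- With both groups presented, homomorphisms in the two directions and agreement on generators
suffice; the order of `G` need not be known. -/
theorem hasQuotientIso_of_hom {E G : Type*} [Group E] [Group G] (N : Subgroup E) [N.Normal]
    (f : E →* G) (g : G →* E ⧸ N) (hN : N ≤ f.ker) (h₁ : g.comp f = QuotientGroup.mk' N)
    (h₂ : (QuotientGroup.lift N f hN).comp g = MonoidHom.id G) : HasQuotientIso N G :=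
  ⟨inferInstance, ⟨MonoidHom.toMulEquiv (QuotientGroup.lift N f hN) g
    (QuotientGroup.monoidHom_ext N h₁) h₂⟩⟩

/-- The order of `G₁`, `G₂`, `G₃` is obtained from that of the extension, so no separate model of
these groups is needed. -/
theorem HasQuotientIso.card_eq {E G : Type*} [Group E] [Group G] {n : E} (hp : p.Prime)
    (hE : Nat.card E = p ^ 5) (hn1 : n ≠ 1) (hnp : n ^ p = 1)
    (h : HasQuotientIso (Subgroup.zpowers n) G) : Nat.card G = p ^ 4 := by
  have := Fact.mk hp
  obtain ⟨_, ⟨e⟩⟩ := h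
  have h1 := (Subgroup.zpowers n).card_mul_index
  rw [hE, Nat.card_zpowers, orderOf_eq_prime hnp hn1, pow_succ' p 4] at h1
  rw [← Nat.card_congr e.toEquiv]
  exact Nat.eq_of_mul_eq_mul_left hp.pos h1

theorem HasQuotientIso.isDistinguished {E G : Type*} [Group E] [Group G] {N : Subgroup E}
    (h : HasQuotientIso N G) (hlt : minimalDegree E < minimalDegree G) : IsDistinguished N := by
  obtain ⟨hN, ⟨e⟩⟩ := h
  exact ⟨hN, minimalDegree_congr e ▸ hlt⟩

theorem two_mul_sq_lt_cube (hp : p.Prime) (hodd : Odd p) : 2 * p ^ 2 < p ^ 3 := by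
  rw [pow_succ' p 2]
  refine Nat.mul_lt_mul_of_pos_right (hp.two_le.lt_of_ne ?_) (pow_pos hp.pos 2)
  rintro rfl
  exact absurd hodd (by decide)

theorem comm_eq_iff {F : Type*} [Group F] {a b c : F} : comm a b = c ↔ a * b = b * a * c := by
  rw [comm, mul_assoc, ← mul_inv_rev, inv_mul_eq_iff_eq_mul]

theorem comm_eq_one_iff {F : Type*} [Group F] {a b : F} : comm a b = 1 ↔ Commute a b := by
  rw [comm_eq_iff, mul_one]; rfl

theorem map_comm {F F' : Type*} [Group F] [Group F'] (φ : F →* F') (a b : F) :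
    φ (comm a b) = comm (φ a) (φ b) := by
  simp only [comm, map_mul, map_inv]

end Abstract

/-! ### Translating the presentations into the multiplied-out relations. -/

section Presentations

variable {p : ℕ} {F : Type*} [Group F]

/-- The function on the three generators with the given values. -/
def Gen3.val (a b c : F) : Gen3 → F
  | .x => a
  | .y => b
  | .z => c

/-- The function on the four generators with the given values. -/
def Gen4.val (a b c d : F) : Gen4 → F
  | .x => a
  | .y => b
  | .z => c
  | .n => d

theorem closure_gen3 (rels : Set (FreeGroup Gen3)) :
    Subgroup.closure {(PresentedGroup.of .x : PresentedGroup rels), .of .y, .of .z} = ⊤ := by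
  rw [← top_le_iff, ← PresentedGroup.closure_range_of, Subgroup.closure_le]
  rintro _ ⟨_ | _ | _, rfl⟩ <;> exact Subgroup.subset_closure (by simp)

theorem closure_gen4 (rels : Set (FreeGroup Gen4)) :
    Subgroup.closure {(PresentedGroup.of .x : PresentedGroup rels), .of .y, .of .z, .of .n} =
      ⊤ := by
  rw [← top_le_iff, ← PresentedGroup.closure_range_of, Subgroup.closure_le]
  rintro _ ⟨_ | _ | _ | _, rfl⟩ <;> exact Subgroup.subset_closure (by simp)

theorem relG1_iff {x y z : F} : (∀ r ∈ relG1 p x y z, r = 1) ↔ ClassTwoRel p x y z 1 := by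
  simp only [relG1, Set.mem_insert_iff, Set.mem_singleton_iff, forall_eq_or_imp, forall_eq,
    mul_inv_eq_one, comm_eq_one_iff, comm_eq_iff (c := x ^ p)]
  constructor
  · rintro ⟨h1, h2, h3, h4, h5, h6⟩
    exact ⟨h1, h2, h3, one_pow p, by rw [mul_one, h6], by rw [mul_one, h5.eq], h4,
      Commute.one_right _, Commute.one_right _, Commute.one_right _⟩
  · intro h
    exact ⟨h.x_pow, h.y_pow, h.z_pow, h.xy, by have := h.xz; rwa [mul_one] at this,
      by have := h.yz; rwa [mul_one] at this⟩

theorem relE1_iff {x y z n : F} : (∀ r ∈ relE1 p x y z n, r = 1) ↔ ClassTwoRel p x y z n := by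
  simp only [relE1, Set.mem_insert_iff, Set.mem_singleton_iff, forall_eq_or_imp, forall_eq,
    mul_inv_eq_one, comm_eq_one_iff, comm_eq_iff (c := n), comm_eq_iff (c := x ^ p * n⁻¹)]
  simp only [← mul_assoc, eq_mul_inv_iff_mul_eq]
  constructor
  · rintro ⟨h1, h2, h3, h4, h5, h6, h7, h8, h9, h10⟩
    exact ⟨h1, h2, h3, h4, h5, h6, h7, h8, h9, h10⟩
  · intro h
    exact ⟨h.x_pow, h.y_pow, h.z_pow, h.n_pow, h.yz, h.xz, h.xy, h.xn, h.yn, h.zn⟩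

theorem relG2_iff {x y z : F} :
    (∀ r ∈ relG2 p x y z, r = 1) ↔ ClassThreeRel p x y z ∧ z ^ p = x ^ p := by
  simp only [relG2, Set.mem_insert_iff, Set.mem_singleton_iff, forall_eq_or_imp, forall_eq,
    mul_inv_eq_one, comm_eq_one_iff, comm_eq_iff (c := x ^ p), comm_eq_iff (c := y)]
  constructor
  · rintro ⟨h1, h2, h3, h4, h5, h6, h7⟩
    exact ⟨⟨h1, h2, h3, h5, h6, h7⟩, h4⟩
  · rintro ⟨h, h4⟩
    exact ⟨h.x_pow, h.w_pow, h.z_pow, h4, h.xw, h.xz, h.wz⟩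

theorem relG3_iff {α : ℤ} {x y z : F} :
    (∀ r ∈ relG3 p α x y z, r = 1) ↔ ClassThreeRel p x y z ∧ z ^ p = x ^ (α * (p : ℤ)) := by
  simp only [relG3, Set.mem_insert_iff, Set.mem_singleton_iff, forall_eq_or_imp, forall_eq,
    mul_inv_eq_one, comm_eq_one_iff, comm_eq_iff (c := x ^ p), comm_eq_iff (c := y)]
  constructor
  · rintro ⟨h1, h2, h3, h4, h5, h6, h7⟩
    exact ⟨⟨h1, h2, h3, h5, h6, h7⟩, h4⟩
  · rintro ⟨h, h4⟩
    exact ⟨h.x_pow, h.w_pow, h.z_pow, h4, h.xw, h.xz, h.wz⟩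

/-- The part of the relations of `E₂` and `E₃` that involves `n` only as a central element of
order dividing `p`. -/
structure CentralRel (p : ℕ) (x w z n : F) : Prop where
  n_pow : n ^ p = 1
  xn : Commute x n
  wn : Commute w n
  zn : Commute z n

theorem relE2_iff {x y z n : F} : (∀ r ∈ relE2 p x y z n, r = 1) ↔
    ClassThreeRel p x y z ∧ CentralRel p x y z n ∧ x ^ p = z ^ p * n := by
  simp only [relE2, Set.mem_insert_iff, Set.mem_singleton_iff, forall_eq_or_imp, forall_eq,
    mul_inv_eq_one, comm_eq_one_iff, comm_eq_iff (c := x ^ p), comm_eq_iff (c := y)]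
  constructor
  · rintro ⟨h1, h2, h3, h4, h5, h6, h7, h8, h9, h10, h11⟩
    exact ⟨⟨h1, h2, h3, h6, h7, h8⟩, ⟨h4, h9, h10, h11⟩, h5⟩
  · rintro ⟨h, h', h5⟩
    exact ⟨h.x_pow, h.w_pow, h.z_pow, h'.n_pow, h5, h.xw, h.xz, h.wz, h'.xn, h'.wn, h'.zn⟩

/-- The substitution `w = y n` with `n` central of order dividing `p` changes neither `w ^ p` nor
the commutators with `x` and `z`, and gives `E₃` the same core relations as `E₂`. -/
theorem relE3_iff {α : ℤ} {x y z n : F} : (∀ r ∈ relE3 p α x y z n, r = 1) ↔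
    ClassThreeRel p x (y * n) z ∧ CentralRel p x (y * n) z n ∧
      z ^ p = x ^ (α * (p : ℤ)) * n := by
  simp only [relE3, Set.mem_insert_iff, Set.mem_singleton_iff, forall_eq_or_imp, forall_eq,
    mul_inv_eq_one, comm_eq_one_iff, comm_eq_iff (c := x ^ p), comm_eq_iff (c := y * n)]
  constructor
  · rintro ⟨h1, h2, h3, h4, h5, h6, h7, h8, h9, h10, h11⟩
    refine ⟨⟨h1, ?_, h3, ?_, h6, h8.mul_left h11.symm⟩,
      ⟨h4, h9, h10.mul_left (Commute.refl n), h11⟩, h5⟩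
    · rw [h10.mul_pow, h2, h4, one_mul]
    · calc x * (y * n) = (x * y) * n := (mul_assoc _ _ _).symm
        _ = y * (x * x ^ p * n) := by rw [h7]; simp only [mul_assoc]
        _ = y * n * x * x ^ p := by
          rw [(h9.mul_left (h9.pow_left p)).eq]; simp only [mul_assoc]
  · rintro ⟨h, h', h5⟩
    have hy : y = y * n * n⁻¹ := (mul_inv_cancel_right y n).symm
    have hyn : Commute y n := by rw [hy]; exact h'.wn.mul_left (Commute.refl n).inv_left
    refine ⟨h.x_pow, ?_, h.z_pow, h'.n_pow, h5, h.xz, ?_, ?_, h'.xn, hyn, h'.zn⟩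
    · have := h.w_pow
      rwa [hyn.mul_pow, h'.n_pow, mul_one] at this
    · have := h.xw
      have h2 : x * y * n = y * x * x ^ p * n := by
        calc x * y * n = y * (n * (x * x ^ p)) := by rw [mul_assoc, this]; simp only [mul_assoc]
          _ = y * x * x ^ p * n := by
            rw [← (h'.xn.mul_left (h'.xn.pow_left p)).eq]; simp only [mul_assoc]
      exact mul_right_cancel h2
    · rw [hy]; exact h.wz.mul_left h'.zn.symm.inv_left

theorem map_relG1 {F' : Type*} [Group F'] (φ : F →* F') (x y z : F) :
    φ '' relG1 p x y z = relG1 p (φ x) (φ y) (φ z) := by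
  simp only [relG1, Set.image_insert_eq, Set.image_singleton, map_mul, map_inv, map_pow, map_comm]

theorem map_relG2 {F' : Type*} [Group F'] (φ : F →* F') (x y z : F) :
    φ '' relG2 p x y z = relG2 p (φ x) (φ y) (φ z) := by
  simp only [relG2, Set.image_insert_eq, Set.image_singleton, map_mul, map_inv, map_pow, map_comm]

theorem map_relG3 {α : ℤ} {F' : Type*} [Group F'] (φ : F →* F') (x y z : F) :
    φ '' relG3 p α x y z = relG3 p α (φ x) (φ y) (φ z) := by
  simp only [relG3, Set.image_insert_eq, Set.image_singleton, map_mul, map_inv, map_pow, map_zpow,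
    map_comm]

theorem map_relE1 {F' : Type*} [Group F'] (φ : F →* F') (x y z n : F) :
    φ '' relE1 p x y z n = relE1 p (φ x) (φ y) (φ z) (φ n) := by
  simp only [relE1, Set.image_insert_eq, Set.image_singleton, map_mul, map_inv, map_pow, map_comm]

theorem map_relE2 {F' : Type*} [Group F'] (φ : F →* F') (x y z n : F) :
    φ '' relE2 p x y z n = relE2 p (φ x) (φ y) (φ z) (φ n) := by
  simp only [relE2, Set.image_insert_eq, Set.image_singleton, map_mul, map_inv, map_pow, map_comm]

theorem map_relE3 {α : ℤ} {F' : Type*} [Group F'] (φ : F →* F') (x y z n : F) :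
    φ '' relE3 p α x y z n = relE3 p α (φ x) (φ y) (φ z) (φ n) := by
  simp only [relE3, Set.image_insert_eq, Set.image_singleton, map_mul, map_inv, map_pow, map_zpow,
    map_comm]

theorem image_mk_eq_one {β : Type*} (rels : Set (FreeGroup β)) :
    ∀ r ∈ PresentedGroup.mk rels '' rels, r = 1 := by
  rintro _ ⟨r, hr, rfl⟩
  exact PresentedGroup.one_of_mem hr

theorem lift_eq_one_of_image {β : Type*} {f : β → F} {rels : Set (FreeGroup β)} {S : Set F}
    (hS : FreeGroup.lift f '' rels = S) (h : ∀ r ∈ S, r = 1) :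
    ∀ r ∈ rels, FreeGroup.lift f r = 1 := fun r hr => h _ (hS ▸ ⟨r, hr, rfl⟩)

theorem ClassTwoRel.map {F' : Type*} [Group F'] {x y z n : F} (h : ClassTwoRel p x y z n)
    (φ : F →* F') : ClassTwoRel p (φ x) (φ y) (φ z) (φ n) := by
  rw [← relE1_iff, ← map_relE1]
  rintro _ ⟨r, hr, rfl⟩
  rw [relE1_iff.2 h r hr, map_one]

theorem ClassThreeRel.map {F' : Type*} [Group F'] {x w z : F} (h : ClassThreeRel p x w z)
    (φ : F →* F') : ClassThreeRel p (φ x) (φ w) (φ z) where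
  x_pow := by rw [← map_pow, h.x_pow, map_one]
  w_pow := by rw [← map_pow, h.w_pow, map_one]
  z_pow := by rw [← map_pow, h.z_pow, map_one]
  xw := by rw [← map_mul, h.xw, map_mul, map_mul, map_pow]
  xz := by rw [← map_mul, h.xz, map_mul, map_mul]
  wz := h.wz.map φ

theorem CentralRel.one (p : ℕ) (x w z : F) : CentralRel p x w z 1 :=
  ⟨one_pow p, Commute.one_right _, Commute.one_right _, Commute.one_right _⟩

end Presentations

open PresentedGroup in
theorem classTwoRel_E1 (p : ℕ) :
    ClassTwoRel p (of .x : E1 p) (of .y) (of .z) (of .n) :=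
  relE1_iff.1 (map_relE1 (mk _) _ _ _ _ ▸ image_mk_eq_one _)

open PresentedGroup in
theorem classTwoRel_G1 (p : ℕ) : ClassTwoRel p (of .x : G1 p) (of .y) (of .z) 1 :=
  relG1_iff.1 (map_relG1 (mk _) _ _ _ ▸ image_mk_eq_one _)

open PresentedGroup in
theorem rel_E2 (p : ℕ) : ClassThreeRel p (of .x : E2 p) (of .y) (of .z) ∧
    CentralRel p (of .x : E2 p) (of .y) (of .z) (of .n) ∧
      (of .x : E2 p) ^ p = (of .z) ^ p * of .n :=
  relE2_iff.1 (map_relE2 (mk _) _ _ _ _ ▸ image_mk_eq_one _)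

open PresentedGroup in
theorem rel_G2 (p : ℕ) : ClassThreeRel p (of .x : G2 p) (of .y) (of .z) ∧
    (of .z : G2 p) ^ p = (of .x) ^ p :=
  relG2_iff.1 (map_relG2 (mk _) _ _ _ ▸ image_mk_eq_one _)

open PresentedGroup in
theorem rel_E3 (p : ℕ) (α : ℤ) : ClassThreeRel p (of .x : E3 p α) (of .y * of .n) (of .z) ∧
    CentralRel p (of .x : E3 p α) (of .y * of .n) (of .z) (of .n) ∧
      (of .z : E3 p α) ^ p = (of .x) ^ (α * (p : ℤ)) * of .n :=
  relE3_iff.1 (map_relE3 (mk _) _ _ _ _ ▸ image_mk_eq_one _)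

open PresentedGroup in
theorem rel_G3 (p : ℕ) (α : ℤ) : ClassThreeRel p (of .x : G3 p α) (of .y) (of .z) ∧
    (of .z : G3 p α) ^ p = (of .x) ^ (α * (p : ℤ)) :=
  relG3_iff.1 (map_relG3 (mk _) _ _ _ ▸ image_mk_eq_one _)

/-! ### Homomorphisms out of the presented groups. -/

section Homs

variable {p : ℕ} {α : ℤ} {F : Type*} [Group F] {x y z n : F}

/-- The homomorphism from `G₁` given by images of the generators. -/
def homG1 (h : ClassTwoRel p x y z 1) : G1 p →* F :=
  PresentedGroup.toGroup (f := Gen3.val x y z)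
    (lift_eq_one_of_image (map_relG1 _ _ _ _) (relG1_iff.2
      (by simpa only [FreeGroup.lift_apply_of, Gen3.val] using h)))

/-- The homomorphism from `E₁` given by images of the generators. -/
def homE1 (h : ClassTwoRel p x y z n) : E1 p →* F :=
  PresentedGroup.toGroup (f := Gen4.val x y z n)
    (lift_eq_one_of_image (map_relE1 _ _ _ _ _) (relE1_iff.2
      (by simpa only [FreeGroup.lift_apply_of, Gen4.val] using h)))

/-- The homomorphism from `G₂` given by images of the generators. -/
def homG2 (h : ClassThreeRel p x y z ∧ z ^ p = x ^ p) : G2 p →* F :=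
  PresentedGroup.toGroup (f := Gen3.val x y z)
    (lift_eq_one_of_image (map_relG2 _ _ _ _) (relG2_iff.2
      (by simpa only [FreeGroup.lift_apply_of, Gen3.val] using h)))

/-- The homomorphism from `E₂` given by images of the generators. -/
def homE2 (h : ClassThreeRel p x y z ∧ CentralRel p x y z n ∧ x ^ p = z ^ p * n) : E2 p →* F :=
  PresentedGroup.toGroup (f := Gen4.val x y z n)
    (lift_eq_one_of_image (map_relE2 _ _ _ _ _) (relE2_iff.2
      (by simpa only [FreeGroup.lift_apply_of, Gen4.val] using h)))

/-- The homomorphism from `G₃` given by images of the generators. -/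
def homG3 (h : ClassThreeRel p x y z ∧ z ^ p = x ^ (α * (p : ℤ))) : G3 p α →* F :=
  PresentedGroup.toGroup (f := Gen3.val x y z)
    (lift_eq_one_of_image (map_relG3 _ _ _ _) (relG3_iff.2
      (by simpa only [FreeGroup.lift_apply_of, Gen3.val] using h)))

/-- The homomorphism from `E₃` given by images of the generators. -/
def homE3 (h : ClassThreeRel p x (y * n) z ∧ CentralRel p x (y * n) z n ∧
    z ^ p = x ^ (α * (p : ℤ)) * n) : E3 p α →* F :=
  PresentedGroup.toGroup (f := Gen4.val x y z n)
    (lift_eq_one_of_image (map_relE3 _ _ _ _ _) (relE3_iff.2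
      (by simpa only [FreeGroup.lift_apply_of, Gen4.val] using h)))

theorem homG1_of (h : ClassTwoRel p x y z 1) (i : Gen3) :
    homG1 h (PresentedGroup.of i) = Gen3.val x y z i := PresentedGroup.toGroup.of _

theorem homE1_of (h : ClassTwoRel p x y z n) (i : Gen4) :
    homE1 h (PresentedGroup.of i) = Gen4.val x y z n i := PresentedGroup.toGroup.of _

theorem homG2_of (h : ClassThreeRel p x y z ∧ z ^ p = x ^ p) (i : Gen3) :
    homG2 h (PresentedGroup.of i) = Gen3.val x y z i := PresentedGroup.toGroup.of _

theorem homE2_of (h : ClassThreeRel p x y z ∧ CentralRel p x y z n ∧ x ^ p = z ^ p * n)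
    (i : Gen4) : homE2 h (PresentedGroup.of i) = Gen4.val x y z n i := PresentedGroup.toGroup.of _

theorem homG3_of (h : ClassThreeRel p x y z ∧ z ^ p = x ^ (α * (p : ℤ))) (i : Gen3) :
    homG3 h (PresentedGroup.of i) = Gen3.val x y z i := PresentedGroup.toGroup.of _

theorem homE3_of (h : ClassThreeRel p x (y * n) z ∧ CentralRel p x (y * n) z n ∧
    z ^ p = x ^ (α * (p : ℤ)) * n) (i : Gen4) :
    homE3 h (PresentedGroup.of i) = Gen4.val x y z n i := PresentedGroup.toGroup.of _

end Homs

/-! ### Quotients by `⟨n⟩` and assembly of the results. -/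

open PresentedGroup

theorem hasQuotientIso_E1 (p : ℕ) [(N1 p).Normal] : HasQuotientIso (N1 p) (G1 p) := by
  have hq := (classTwoRel_E1 p).map (QuotientGroup.mk' (N1 p))
  have hn1 : QuotientGroup.mk' (N1 p) (of .n) = 1 :=
    (QuotientGroup.eq_one_iff _).2 (Subgroup.mem_zpowers _)
  rw [hn1] at hq
  refine hasQuotientIso_of_hom (N1 p) (homE1 (classTwoRel_G1 p)) (homG1 hq) ?_ ?_ ?_
  · exact Subgroup.zpowers_le.2 (MonoidHom.mem_ker.2 (homE1_of _ _))
  · refine PresentedGroup.ext fun i => ?_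
    rw [MonoidHom.comp_apply, homE1_of]
    cases i
    · exact homG1_of _ _
    · exact homG1_of _ _
    · exact homG1_of _ _
    · exact (map_one _).trans hn1.symm
  · refine PresentedGroup.ext fun i => ?_
    rw [MonoidHom.comp_apply, homG1_of]
    cases i <;> exact homE1_of (classTwoRel_G1 p) _

theorem hasQuotientIso_E2 (p : ℕ) [(N2 p).Normal] : HasQuotientIso (N2 p) (G2 p) := by
  obtain ⟨hE, -, hEn⟩ := rel_E2 p
  have hq := hE.map (QuotientGroup.mk' (N2 p))
  have hn1 : QuotientGroup.mk' (N2 p) (of .n) = 1 :=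
    (QuotientGroup.eq_one_iff _).2 (Subgroup.mem_zpowers _)
  have hqn := congrArg (QuotientGroup.mk' (N2 p)) hEn
  rw [map_mul, hn1, mul_one, map_pow, map_pow] at hqn
  obtain ⟨hG, hGn⟩ := rel_G2 p
  have hf : ClassThreeRel p (of .x : G2 p) (of .y) (of .z) ∧
      CentralRel p (of .x : G2 p) (of .y) (of .z) 1 ∧ (of .x : G2 p) ^ p = (of .z) ^ p * 1 :=
    ⟨hG, CentralRel.one _ _ _ _, by rw [mul_one, hGn]⟩
  refine hasQuotientIso_of_hom (N2 p) (homE2 hf) (homG2 ⟨hq, hqn.symm⟩) ?_ ?_ ?_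
  · exact Subgroup.zpowers_le.2 (MonoidHom.mem_ker.2 (homE2_of _ _))
  · refine PresentedGroup.ext fun i => ?_
    rw [MonoidHom.comp_apply, homE2_of]
    cases i
    · exact homG2_of _ _
    · exact homG2_of _ _
    · exact homG2_of _ _
    · exact (map_one _).trans hn1.symm
  · refine PresentedGroup.ext fun i => ?_
    rw [MonoidHom.comp_apply, homG2_of]
    cases i <;> exact homE2_of hf _

theorem hasQuotientIso_E3 (p : ℕ) (α : ℤ) [(N3 p α).Normal] :
    HasQuotientIso (N3 p α) (G3 p α) := by
  obtain ⟨hE, -, hEn⟩ := rel_E3 p α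
  have hq := hE.map (QuotientGroup.mk' (N3 p α))
  have hn1 : QuotientGroup.mk' (N3 p α) (of .n) = 1 :=
    (QuotientGroup.eq_one_iff _).2 (Subgroup.mem_zpowers _)
  have hqn := congrArg (QuotientGroup.mk' (N3 p α)) hEn
  rw [map_mul, hn1, mul_one, map_pow, map_zpow] at hqn
  rw [map_mul, hn1, mul_one] at hq
  obtain ⟨hG, hGn⟩ := rel_G3 p α
  have hf : ClassThreeRel p (of .x : G3 p α) (of .y * 1) (of .z) ∧
      CentralRel p (of .x : G3 p α) (of .y * 1) (of .z) 1 ∧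
      (of .z : G3 p α) ^ p = (of .x) ^ (α * (p : ℤ)) * 1 :=
    ⟨by rwa [mul_one], CentralRel.one _ _ _ _, by rw [mul_one, hGn]⟩
  refine hasQuotientIso_of_hom (N3 p α) (homE3 hf) (homG3 ⟨hq, hqn⟩) ?_ ?_ ?_
  · exact Subgroup.zpowers_le.2 (MonoidHom.mem_ker.2 (homE3_of _ _))
  · refine PresentedGroup.ext fun i => ?_
    rw [MonoidHom.comp_apply, homE3_of]
    cases i
    · exact homG3_of _ _
    · exact homG3_of _ _
    · exact homG3_of _ _
    · exact (map_one _).trans hn1.symm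
  · refine PresentedGroup.ext fun i => ?_
    rw [MonoidHom.comp_apply, homG3_of]
    cases i <;> exact homE3_of hf _

theorem classThreeGen_E2 (p : ℕ) : ClassThreeGen p (of .x : E2 p) (of .y) (of .z) where
  toClassThreeRel := (rel_E2 p).1
  gen := by
    rw [← top_le_iff, ← closure_gen4, Subgroup.closure_le]
    set S := Subgroup.closure {(of .x : E2 p), of .y, of .z}
    have hx : (of .x : E2 p) ∈ S := Subgroup.subset_closure (by simp)
    have hy : (of .y : E2 p) ∈ S := Subgroup.subset_closure (by simp)
    have hz : (of .z : E2 p) ∈ S := Subgroup.subset_closure (by simp)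
    -- The relation `x ^ p = z ^ p * n` expresses `n` through `x` and `z`.
    have hn : (of .n : E2 p) ∈ S := by
      rw [← S.mul_mem_cancel_left (S.pow_mem hz p), ← (rel_E2 p).2.2]
      exact S.pow_mem hx p
    rintro t (rfl | rfl | rfl | rfl) <;> assumption

theorem classThreeGen_E3 (p : ℕ) (α : ℤ) :
    ClassThreeGen p (of .x : E3 p α) (of .y * of .n) (of .z) where
  toClassThreeRel := (rel_E3 p α).1
  gen := by
    rw [← top_le_iff, ← closure_gen4, Subgroup.closure_le]
    set S := Subgroup.closure {(of .x : E3 p α), of .y * of .n, of .z}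
    have hx : (of .x : E3 p α) ∈ S := Subgroup.subset_closure (by simp)
    have hw : (of .y * of .n : E3 p α) ∈ S := Subgroup.subset_closure (by simp)
    have hz : (of .z : E3 p α) ∈ S := Subgroup.subset_closure (by simp)
    have hn : (of .n : E3 p α) ∈ S := by
      rw [← S.mul_mem_cancel_left (S.zpow_mem hx (α * p)), ← (rel_E3 p α).2.2]
      exact S.pow_mem hz p
    have hy : (of .y : E3 p α) ∈ S := (S.mul_mem_cancel_right hn).1 hw
    rintro t (rfl | rfl | rfl | rfl) <;> assumption

theorem isExceptional_of_isDistinguished {E : Type*} [Group E] {N : Subgroup E} {k : ℕ}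
    (hcard : Nat.card E = k) (hk : k ≠ 0) (h : IsDistinguished N) : IsExceptional E :=
  ⟨Nat.finite_of_card_ne_zero (hcard ▸ hk), N, h⟩

theorem E1_spec {p : ℕ} (hp : p.Prime) (hodd : Odd p) :
    Nat.card (E1 p) = p ^ 5 ∧ minimalDegree (E1 p) = 2 * p ^ 2 ∧ IsExceptional (E1 p) ∧
      N1 p ≤ Subgroup.center (E1 p) ∧ IsDistinguished (N1 p) ∧ HasQuotientIso (N1 p) (G1 p) ∧
      2 * p ^ 2 < minimalDegree (G1 p) := by
  have hE : ClassTwoGen p (of .x : E1 p) (of .y) (of .z) (of .n) :=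
    ⟨classTwoRel_E1 p, closure_gen4 _⟩
  have hG : ClassTwoGen p (of .x : G1 p) (of .y) (of .z) 1 := by
    refine ⟨classTwoRel_G1 p, ?_⟩
    rw [← top_le_iff, ← closure_gen3]
    exact Subgroup.closure_mono (by
      rintro t (rfl | rfl | rfl) <;> simp)
  obtain ⟨hcard, hdeg, hn1⟩ := hE.card_and_minimalDegree hp (homE1 classTwoRel_model)
    (homE1_of _ _) (homE1_of _ _) (homE1_of _ _) (homE1_of _ _)
  have hN : (N1 p).Normal := normal_zpowers_of_mem_center hE.n_mem_center
  have hquot := hasQuotientIso_E1 p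
  have hGcard := HasQuotientIso.card_eq hp hcard hn1 hE.n_pow hquot
  have : Finite (G1 p) := Nat.finite_of_card_ne_zero (hGcard ▸ pow_ne_zero 4 hp.ne_zero)
  have hlt := (two_mul_sq_lt_cube hp hodd).trans_le (hG.cube_le_minimalDegree hp hGcard)
  have hdist := hquot.isDistinguished (hdeg ▸ hlt)
  exact ⟨hcard, hdeg, isExceptional_of_isDistinguished hcard (pow_ne_zero 5 hp.ne_zero) hdist,
    Subgroup.zpowers_le.2 hE.n_mem_center, hdist, hquot, hlt⟩

/-- The common final step for `E₂` and `E₃`. -/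
theorem ClassThreeGen.spec {p k : ℕ} (hp : p.Prime) (hodd : Odd p) {E G : Type*} [Group E]
    [Group G] {x w z n : E} (hE : ClassThreeGen p x w z) (hcen : CentralRel p x w z n)
    (φ : E →* Equiv.Perm (ZMod (p ^ 2)) × Multiplicative (ZMod (p ^ 2)))
    (hx : φ x = modelX p) (hw : φ w = modelW p) (hz : φ z = modelZ p) (hn : n ≠ 1)
    (hquot : (Subgroup.zpowers n).Normal → HasQuotientIso (Subgroup.zpowers n) G)
    {x' w' z' : G} (hG : ClassThreeGen p x' w' z') (hzx : z' ^ p = (x' ^ p) ^ k) (hk : ¬ p ∣ k)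
    (χ : G →* Multiplicative (ZMod p)) (hχx : χ x' = Multiplicative.ofAdd 1) (hχw : χ w' = 1)
    (hχz : χ z' = 1) :
    Nat.card E = p ^ 5 ∧ minimalDegree E = 2 * p ^ 2 ∧ IsExceptional E ∧
      Subgroup.zpowers n ≤ Subgroup.center E ∧ IsDistinguished (Subgroup.zpowers n) ∧
      HasQuotientIso (Subgroup.zpowers n) G ∧ minimalDegree G = p ^ 3 := by
  obtain ⟨hcard, hdeg⟩ := hE.card_and_minimalDegree hp hodd φ hx hw hz
  have hnc : n ∈ Subgroup.center E := hE.mem_center_of_commute hcen.xn hcen.wn hcen.zn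
  have hquot := hquot (normal_zpowers_of_mem_center hnc)
  have hGcard := HasQuotientIso.card_eq hp hcard hn hcen.n_pow hquot
  have : Finite G := Nat.finite_of_card_ne_zero (hGcard ▸ pow_ne_zero 4 hp.ne_zero)
  have hGdeg := hG.minimalDegree_eq_cube hzx hk hp hodd hGcard χ hχx hχw hχz
  have hdist := hquot.isDistinguished (by rw [hdeg, hGdeg]; exact two_mul_sq_lt_cube hp hodd)
  exact ⟨hcard, hdeg, isExceptional_of_isDistinguished hcard (pow_ne_zero 5 hp.ne_zero) hdist,
    Subgroup.zpowers_le.2 hnc, hdist, hquot, hGdeg⟩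

/-- The second coordinate is trivial on powers of `x` but not on `z ^ p`. This is what shows `n ≠ 1`
in `E₂` and `E₃`. -/
theorem modelZ_pow_ne_modelX_zpow {p : ℕ} (hp : p.Prime) (k : ℤ) :
    modelZ p ^ p ≠ modelX p ^ k := by
  intro h
  have h1 := congrArg Prod.snd h
  rw [Prod.pow_snd, Prod.pow_snd] at h1
  change Multiplicative.ofAdd (1 : ZMod (p ^ 2)) ^ p = 1 ^ k at h1
  rw [← ofAdd_nsmul, nsmul_one, one_zpow, ofAdd_eq_one, ZMod.natCast_eq_zero_iff] at h1
  have := Nat.le_of_dvd hp.pos h1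
  nlinarith [hp.two_le]

/-- These are the relations needed for the character `x ↦ 1`, `y, z ↦ 0` of `G₂` and `G₃` with
values in `ℤ/p`. -/
theorem classThreeRel_character (p : ℕ) {q : ℕ} (hq : p ∣ q) :
    ClassThreeRel p (Multiplicative.ofAdd (1 : ZMod p)) 1 1 ∧
      (1 : Multiplicative (ZMod p)) ^ p = Multiplicative.ofAdd 1 ^ q := by
  have h1 (q : ℕ) (hq : p ∣ q) : Multiplicative.ofAdd (1 : ZMod p) ^ q = 1 := by
    rw [← ofAdd_nsmul, nsmul_one, ofAdd_eq_one, ZMod.natCast_eq_zero_iff]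
    exact hq
  refine ⟨⟨h1 _ (dvd_pow_self p two_ne_zero), one_pow _, one_pow _, ?_, ?_, Commute.one_left _⟩,
    by rw [h1 q hq, one_pow]⟩
  · rw [h1 p dvd_rfl, mul_one, mul_one, one_mul]
  · rw [mul_one, mul_one, one_mul]

theorem E2_spec {p : ℕ} (hp : p.Prime) (hodd : Odd p) :
    Nat.card (E2 p) = p ^ 5 ∧ minimalDegree (E2 p) = 2 * p ^ 2 ∧ IsExceptional (E2 p) ∧
      N2 p ≤ Subgroup.center (E2 p) ∧ IsDistinguished (N2 p) ∧ HasQuotientIso (N2 p) (G2 p) ∧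
      minimalDegree (G2 p) = p ^ 3 := by
  obtain ⟨-, hcen, hn⟩ := rel_E2 p
  have hM := classThreeRel_model hodd
  have hMx := hM.z_xp hp hodd
  have hMz := hM.x_zp
  -- The relation `x ^ p = z ^ p * n` leaves this as the only possible image of `n`.
  have hMcen : CentralRel p (modelX p) (modelW p) (modelZ p)
      ((modelZ p ^ p)⁻¹ * modelX p ^ p) := by
    refine ⟨?_, ?_, ?_, ?_⟩
    · rw [((hMx.pow_left p).inv_left).mul_pow, inv_pow, hM.zp_pow, hM.xp_pow, inv_one, one_mul]
    · exact hMz.inv_right.mul_right (Commute.self_pow _ _)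
    · exact (hM.wz.pow_right p).inv_right.mul_right hM.w_xp
    · exact (Commute.self_pow _ _).inv_right.mul_right hMx
  let φ := homE2 ⟨hM, hMcen, (mul_inv_cancel_left _ _).symm⟩
  have hn1 : (of .n : E2 p) ≠ 1 := by
    intro h0
    have h1 := congrArg φ hn
    rw [h0, mul_one, map_pow, map_pow, homE2_of, homE2_of] at h1
    exact modelZ_pow_ne_modelX_zpow hp p (by rw [zpow_natCast]; exact h1.symm)
  refine ClassThreeGen.spec (k := 1) hp hodd (classThreeGen_E2 p) hcen φ (homE2_of _ _)
    (homE2_of _ _) (homE2_of _ _) hn1 (fun hN => @hasQuotientIso_E2 p hN)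
    ⟨(rel_G2 p).1, closure_gen3 _⟩ (by rw [pow_one, (rel_G2 p).2])
    (fun hd => hp.one_lt.ne' (Nat.dvd_one.1 hd)) (homG2 (classThreeRel_character p dvd_rfl))
    (homG2_of _ _) (homG2_of _ _) (homG2_of _ _)

theorem E3_spec {p : ℕ} (hp : p.Prime) (hodd : Odd p) {α : ℤ} (hα : (α : ZMod p) ≠ 0) :
    Nat.card (E3 p α) = p ^ 5 ∧ minimalDegree (E3 p α) = 2 * p ^ 2 ∧ IsExceptional (E3 p α) ∧
      N3 p α ≤ Subgroup.center (E3 p α) ∧ IsDistinguished (N3 p α) ∧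
      HasQuotientIso (N3 p α) (G3 p α) ∧ minimalDegree (G3 p α) = p ^ 3 := by
  have := NeZero.mk hp.ne_zero
  obtain ⟨-, hcen, hn⟩ := rel_E3 p α
  have hM := classThreeRel_model hodd
  have hMx := hM.z_xp hp hodd
  have hMz := hM.x_zp
  have hpow (x : Equiv.Perm (ZMod (p ^ 2)) × Multiplicative (ZMod (p ^ 2))) :
      x ^ (α * (p : ℤ)) = (x ^ p) ^ α := by
    rw [mul_comm, zpow_mul, zpow_natCast]
  have hMcen : CentralRel p (modelX p) (modelW p) (modelZ p)
      ((modelX p ^ (α * (p : ℤ)))⁻¹ * modelZ p ^ p) := by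
    rw [hpow]
    refine ⟨?_, ?_, ?_, ?_⟩
    · have hc : Commute ((modelX p ^ p) ^ α)⁻¹ (modelZ p ^ p) :=
        ((hMx.pow_left p).zpow_right α).inv_right.symm
      have hα : ((modelX p ^ p) ^ α) ^ p = 1 := by
        rw [← zpow_natCast, ← zpow_mul, mul_comm, zpow_mul, zpow_natCast, hM.xp_pow, one_zpow]
      rw [hc.mul_pow, inv_pow, hM.zp_pow, hα, inv_one, one_mul]
    · exact ((Commute.self_pow _ _).zpow_right α).inv_right.mul_right hMz
    · exact (hM.w_xp.zpow_right α).inv_right.mul_right (hM.wz.pow_right p)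
    · exact (hMx.zpow_right α).inv_right.mul_right (Commute.self_pow _ _)
  set ν := (modelX p ^ (α * (p : ℤ)))⁻¹ * modelZ p ^ p with hν
  -- Since `w = y n`, sending `w` to `modelW p` and `n` to `ν` forces the image of `y`.
  let φ : E3 p α →* _ := homE3 (x := modelX p) (y := modelW p * ν⁻¹) (z := modelZ p) (n := ν)
    ⟨by rwa [inv_mul_cancel_right], by rwa [inv_mul_cancel_right],
      (mul_inv_cancel_left _ _).symm⟩
  have hφw : φ (of .y * of .n) = modelW p := by
    rw [map_mul, homE3_of, homE3_of]
    exact inv_mul_cancel_right _ _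
  have hn1 : (of .n : E3 p α) ≠ 1 := by
    intro h0
    have h1 := congrArg φ hn
    rw [h0, mul_one, map_pow, map_zpow, homE3_of, homE3_of] at h1
    exact modelZ_pow_ne_modelX_zpow hp _ h1
  have hk : ((α : ZMod p).val : ℤ) = α % p := ZMod.val_intCast α
  have hchar := classThreeRel_character p (dvd_refl p)
  have hG := (rel_G3 p α).1
  -- As `x ^ p` has `p`-th power `1`, the exponent `α` may be replaced by its residue modulo `p`,
  -- which is nonzero.
  refine ClassThreeGen.spec (k := (α : ZMod p).val) hp hodd (classThreeGen_E3 p α) hcen φ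
    (homE3_of _ _) hφw (homE3_of _ _) hn1 (fun hN => @hasQuotientIso_E3 p α hN)
    ⟨hG, closure_gen3 _⟩ ?_ ?_ (homG3 ⟨hchar.1, ?_⟩)
    (homG3_of _ _) (homG3_of _ _) (homG3_of _ _)
  · rw [(rel_G3 p α).2, ← zpow_natCast (_ ^ p), hk, mul_comm, zpow_mul, zpow_natCast]
    refine (congrArg (_ ^ ·) (Int.emod_add_mul_ediv α p).symm).trans ?_
    rw [zpow_add, zpow_mul, zpow_natCast, hG.xp_pow, one_zpow, mul_one]
  · intro hd
    have h0 := Nat.eq_zero_of_dvd_of_lt hd (ZMod.val_lt _)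
    exact hα ((ZMod.val_eq_zero _).1 h0)
  · rw [mul_comm, zpow_mul, zpow_natCast, ← hchar.2, one_pow, one_zpow]

end ExceptionalPGroups

theorem theorem5 (p : ℕ) (hp : p.Prime) (hodd : Odd p) :
    (Nat.card (ExceptionalPGroups.E1 p) = p ^ 5 ∧
      ExceptionalPGroups.minimalDegree (ExceptionalPGroups.E1 p) = 2 * p ^ 2 ∧
      ExceptionalPGroups.IsExceptional (ExceptionalPGroups.E1 p) ∧
      ExceptionalPGroups.N1 p ≤ Subgroup.center (ExceptionalPGroups.E1 p) ∧
      ExceptionalPGroups.IsDistinguished (ExceptionalPGroups.N1 p) ∧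
      ExceptionalPGroups.HasQuotientIso (ExceptionalPGroups.N1 p) (ExceptionalPGroups.G1 p) ∧
      2 * p ^ 2 < ExceptionalPGroups.minimalDegree (ExceptionalPGroups.G1 p)) ∧
    (Nat.card (ExceptionalPGroups.E2 p) = p ^ 5 ∧
      ExceptionalPGroups.minimalDegree (ExceptionalPGroups.E2 p) = 2 * p ^ 2 ∧
      ExceptionalPGroups.IsExceptional (ExceptionalPGroups.E2 p) ∧
      ExceptionalPGroups.N2 p ≤ Subgroup.center (ExceptionalPGroups.E2 p) ∧
      ExceptionalPGroups.IsDistinguished (ExceptionalPGroups.N2 p) ∧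
      ExceptionalPGroups.HasQuotientIso (ExceptionalPGroups.N2 p) (ExceptionalPGroups.G2 p) ∧
      ExceptionalPGroups.minimalDegree (ExceptionalPGroups.G2 p) = p ^ 3) ∧
    (∀ α : ℤ, ¬ IsSquare (α : ZMod p) →
      Nat.card (ExceptionalPGroups.E3 p α) = p ^ 5 ∧
      ExceptionalPGroups.minimalDegree (ExceptionalPGroups.E3 p α) = 2 * p ^ 2 ∧
      ExceptionalPGroups.IsExceptional (ExceptionalPGroups.E3 p α) ∧
      ExceptionalPGroups.N3 p α ≤ Subgroup.center (ExceptionalPGroups.E3 p α) ∧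
      ExceptionalPGroups.IsDistinguished (ExceptionalPGroups.N3 p α) ∧
      ExceptionalPGroups.HasQuotientIso (ExceptionalPGroups.N3 p α)
        (ExceptionalPGroups.G3 p α) ∧
      ExceptionalPGroups.minimalDegree (ExceptionalPGroups.G3 p α) = p ^ 3) :=
  ⟨ExceptionalPGroups.E1_spec hp hodd, ExceptionalPGroups.E2_spec hp hodd, fun _ hα =>
    ExceptionalPGroups.E3_spec hp hodd fun h0 => hα (h0 ▸ IsSquare.zero)⟩
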